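/- Let $F$ (facilities) and $C$ (clients) be finite sets, and let $$P_{FL}=\Big\{(x,y)\in\mathbb R^{F\times C}\times\mathbb R^{F} : \sum_{i\in F}x_{ij}=1\ \forall j\in C,\ \ x_{ij}\le y_i\ \forall i\in F, j\in C,\ \ x,y\ge 0\Big\}.$$ Let $o\in[0,1]^F$, and let $(x^A,y^A),(x^B,y^B)\in P_{FL}$ be preprocessed with respect to $o$: for $(x,y)$ either of the two pairs, $x_{ij}\in\{0,y_i\}$ and $y_i\in\{0,o_i\}$ for all $i\in F$, $j\in C$. Let the clocks $Q_i\sim\mathrm{Exp}(o_i)$ (for $i\in F$ with $o_i>0$) and $R_j\sim\mathrm{Exp}(1)$ (for $j\in C$) be independent exponential random variables; almost surely they are pairwise distinct. For $x\in\{x^A,x^B\}$, the support graph of $x$ is the bipartite graph on $F^x\cup C$, where $F^x=\{i\in F:\exists j\in C,\ x_{ij}>0\}$, with an edge $\{i,j\}$ if and only if $x_{ij}>0$ (so only facilities with $o_i>0$ occur). The connection graph of $x$ is the directed graph on the same vertices in which every vertex has exactly one outgoing arc, directed to its neighbor in the support graph with the smallest clock. The connection path $P_j(x)$ of a client $j$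 starts at $j$ and follows outgoing arcs of the connection graph until just before it would visit a vertex that it has already visited; $j$ is assigned to the facility that appears latest on $P_j(x)$. The same clocks are used for $x^A$ and $x^B$. 1. If for some client $k\in C$ we have $x^A_{ij}=x^B_{ij}$ for all $i\in F$ and $j\in C\setminus\{k\}$, then $\mathbb E\big[\,|\{j\in C: P_j(x^A)\neq P_j(x^B)\}|\,\big]\le 7$. 2. If for some $K\subseteq C$ we have $x^A_{ij}=x^B_{ij}$ for all $i\in F$ and $j\in C\setminus K$, then the expected number of clients that are assigned to different facilities for $x^A$ and for $x^B$ is at most $7|K|$. -/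

import Mathlib

open MeasureTheory ProbabilityTheory

namespace DynamicFacility

noncomputable section

/-- The standard polytope of the facility location relaxation: pairs `(x, y)` where `x i j` is the
connection variable of facility `i` and client `j`, and `y i` the opening variable of `i`. -/
def pFL (F C : Type*) [Fintype F] : Set ((F → C → ℝ) × (F → ℝ)) :=
  {p | (∀ j, ∑ i, p.1 i j = 1) ∧ (∀ i j, p.1 i j ≤ p.2 i) ∧
    (∀ i j, 0 ≤ p.1 i j) ∧ (∀ i, 0 ≤ p.2 i)}

/-- `(x, y)` is preprocessed with respect to `o`: each connection variable is `0` or equal to the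
opening variable of its facility, and each opening variable `y i` is `0` or `o i`. -/
def Preprocessed {F C : Type*} (o : F → ℝ) (x : F → C → ℝ) (y : F → ℝ) : Prop :=
  (∀ i j, x i j = 0 ∨ x i j = y i) ∧ (∀ i, y i = 0 ∨ y i = o i)

/-- The support graph of `x`. Facilities are `Sum.inl i`, clients are `Sum.inr j`; facility `i` and
client `j` are adjacent iff `x i j > 0`. Facilities that no client uses are isolated vertices, and
are never visited below. -/
def supportGraph {F C : Type*} (x : F → C → ℝ) : SimpleGraph (F ⊕ C) where
  Adj v w := (∃ i j, v = Sum.inl i ∧ w = Sum.inr j ∧ 0 < x i j) ∨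
    (∃ i j, v = Sum.inr j ∧ w = Sum.inl i ∧ 0 < x i j)
  symm := ⟨by
    rintro v w (⟨i, j, hv, hw, h⟩ | ⟨i, j, hv, hw, h⟩)
    · exact Or.inr ⟨i, j, hw, hv, h⟩
    · exact Or.inl ⟨i, j, hw, hv, h⟩⟩
  loopless := ⟨by
    rintro v (⟨i, j, hv, hw, -⟩ | ⟨i, j, hv, hw, -⟩)
    · exact Sum.inl_ne_inr (hv.symm.trans hw)
    · exact Sum.inr_ne_inl (hv.symm.trans hw)⟩

/-- The connection graph of `x` for the clock values `t`: there is an arc from `v` to the neighbour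
of `v` in the support graph that has the smallest clock. (Almost surely all clocks are distinct, so
that every non-isolated vertex has exactly one outgoing arc.) -/
def connectionGraph {F C : Type*} (x : F → C → ℝ) (t : F ⊕ C → ℝ) : Digraph (F ⊕ C) where
  Adj v w := (supportGraph x).Adj v w ∧ ∀ u, (supportGraph x).Adj v u → t w ≤ t u

/-- A non-isolated vertex has an outgoing arc. -/
theorem exists_arc {F C : Type*} [Finite F] [Finite C] (x : F → C → ℝ) (t : F ⊕ C → ℝ)
    {v u : F ⊕ C} (h : (supportGraph x).Adj v u) : ∃ w, (connectionGraph x t).Adj v w := by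
  obtain ⟨w, hw, hmin⟩ := Set.exists_min_image {w | (supportGraph x).Adj v w} t
    (Set.toFinite _) ⟨u, h⟩
  exact ⟨w, hw, hmin⟩

open Classical in
/-- The head of the outgoing arc of `v` in the connection graph (a choice of one in the
probability-zero event of ties; the vertex `v` itself if `v` is isolated). -/
def next {F C : Type*} (x : F → C → ℝ) (t : F ⊕ C → ℝ) (v : F ⊕ C) : F ⊕ C :=
  if h : ∃ w, (connectionGraph x t).Adj v w then h.choose else v

/-- The number of vertices on the walk from client `j` along outgoing arcs until just before it
would visit a vertex that it has already visited. -/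
def pathLength {F C : Type*} (x : F → C → ℝ) (t : F ⊕ C → ℝ) (j : C) : ℕ :=
  sInf {n | ∃ m < n, (next x t)^[m] (Sum.inr j) = (next x t)^[n] (Sum.inr j)}

/-- The infimum in `pathLength` is over a nonempty set, so it is attained. -/
theorem pathLength_spec {F C : Type*} [Finite F] [Finite C] (x : F → C → ℝ) (t : F ⊕ C → ℝ)
    (j : C) : ∃ m < pathLength x t j,
      (next x t)^[m] (Sum.inr j) = (next x t)^[pathLength x t j] (Sum.inr j) := by
  have hne : {n | ∃ m < n, (next x t)^[m] (Sum.inr j : F ⊕ C)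
      = (next x t)^[n] (Sum.inr j)}.Nonempty := by
    obtain ⟨a, b, hab, h⟩ := Finite.exists_ne_map_eq_of_infinite
      (fun n : ℕ => (next x t)^[n] (Sum.inr j : F ⊕ C))
    rcases lt_or_gt_of_ne hab with hlt | hlt
    · exact ⟨b, a, hlt, h⟩
    · exact ⟨a, b, hlt, h.symm⟩
  exact Nat.sInf_mem hne

/-- The connection path of client `j`, as the list of its vertices. -/
def connectionPath {F C : Type*} (x : F → C → ℝ) (t : F ⊕ C → ℝ) (j : C) : List (F ⊕ C) :=
  (List.range (pathLength x t j)).map fun n => (next x t)^[n] (Sum.inr j)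

/-- The facility to which client `j` is assigned: the one that appears latest on its connection
path. -/
def assigned {F C : Type*} (x : F → C → ℝ) (t : F ⊕ C → ℝ) (j : C) : Option F :=
  ((connectionPath x t j).filterMap Sum.getLeft?).getLast?

/-- The rates of the clocks: `o i` for facility `i`, and `1` for every client. -/
def rate {F : Type*} (C : Type*) (o : F → ℝ) : F ⊕ C → ℝ :=
  Sum.elim o fun _ => 1

/-- The clocks `T v` of positive rate `r v` are independent exponential random variables with these
rates. (A facility of rate `0` can have no edge in a support graph; nothing is asked of its clock,
which is never looked at.) -/
structure IsExponentialClocks {V Ω : Type*} [MeasurableSpace Ω] (r : V → ℝ) (T : V → Ω → ℝ)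
    (P : Measure Ω) : Prop where
  hasLaw : ∀ v, 0 < r v → HasLaw (T v) (expMeasure (r v)) P
  indep : iIndepFun (fun v : {v // 0 < r v} => T v) P

/-- The number of clients whose connection paths for `xA` and `xB` differ, when both connection
graphs are built from the clock values `t`. -/
def numPathChanges {F C : Type*} (xA xB : F → C → ℝ) (t : F ⊕ C → ℝ) : ℕ :=
  {j : C | connectionPath xA t j ≠ connectionPath xB t j}.ncard

/-- The number of clients that are assigned to different facilities for `xA` and `xB`, when both
connection graphs are built from the clock values `t`. -/
def numReassigned {F C : Type*} (xA xB : F → C → ℝ) (t : F ⊕ C → ℝ) : ℕ :=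
  {j : C | assigned xA t j ≠ assigned xB t j}.ncard

end

end DynamicFacility

/-! Away from the changed client `k` the two support graphs agree, so a client's path can change
only if its walk for `xA` or for `xB` visits `k`. Hence at most 1 + N_A + N_B paths change, where N
counts the other clients whose walk visits `k`. It remains to show E[N] ≤ 3 for one graph; then 1 +
3 + 3 = 7.

Along a walk, every new vertex has the smallest clock among all clocks inspected so far on its side
(`head_le_of_mem_pathEvent`). So until the first visit to `k` a walk meets only fresh vertices
(`isFreshWalk_seqTail`), and by memorylessness the probability that it continues to a fresh `w` is
at most the rate of `w` over the total rate of the exposed clocks (`clockLaw_pathEvent_cons_le`).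

Now sum over all walks into `k`, traced backwards. A step from a facility `Y` to a client costs at
most 1 / deg `Y`, which pays for the choice of the client preceding `Y`. For the choice of
facilities, let a walk pass X₂, Y₂, X', Y, X in this order, and let D ≤ 1 be the rate of the
neighbours of X' that are not neighbours of X. When the walk leaves X, clocks of rate at least 1 + D
are exposed; freshness forces Y₂ to be among the neighbours counted by D. Charging that denominator
to the choice of Y₂ gives a factor D / (1 + D) ≤ 1/2 per round trip. The walks of length 2, 4, 6, 8,
... therefore contribute at most 1, 1, 1/2, 1/4, ..., in total at most 3.

For several changed clients, change one at a time and use the triangle inequality; a client with an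
unchanged path keeps its facility. -/

namespace DynamicFacility

/-! ### Independent exponential clocks and memorylessness -/

section Clocks

open scoped ENNReal

theorem expMeasure_eq_withDensity (r : ℝ) :
    expMeasure r = volume.withDensity (exponentialPDF r) := rfl

theorem measurable_exponentialPDF (r : ℝ) : Measurable (exponentialPDF r) :=
  (measurable_exponentialPDFReal r).ennreal_ofReal

/-- The memoryless property of the exponential distribution. -/
theorem expMeasure_restrict_Ici {r a : ℝ} (ha : 0 ≤ a) :
    (expMeasure r).restrict (Set.Ici a) =
      ENNReal.ofReal (Real.exp (-(r * a))) • (expMeasure r).map (· + a) := by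
  ext s hs
  have hadd : Measurable (fun x : ℝ => x + a) := measurable_add_const a
  rw [Measure.restrict_apply hs, Measure.smul_apply, Measure.map_apply hadd hs,
    expMeasure_eq_withDensity, withDensity_apply _ (hs.inter measurableSet_Ici),
    withDensity_apply _ (hadd hs), smul_eq_mul,
    ← lintegral_indicator (hs.inter measurableSet_Ici), ← lintegral_indicator (hadd hs),
    ← lintegral_add_right_eq_self _ a, ← lintegral_const_mul _
      ((measurable_exponentialPDF r).indicator (hadd hs))]
  refine lintegral_congr fun x => ?_
  by_cases hx : x + a ∈ s
  · by_cases h0 : 0 ≤ x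
    · have h1 : x + a ∈ s ∩ Set.Ici a := ⟨hx, by simpa using h0⟩
      have h2 : x ∈ (fun x => x + a) ⁻¹' s := hx
      rw [Set.indicator_of_mem h1, Set.indicator_of_mem h2, exponentialPDF_of_nonneg h0,
        exponentialPDF_of_nonneg (add_nonneg h0 ha), ← ENNReal.ofReal_mul (Real.exp_pos _).le]
      congr 1
      rw [mul_add, neg_add, Real.exp_add]
      ring
    · have h1 : x + a ∉ s ∩ Set.Ici a := fun h => h0 (by simpa using h.2)
      have h2 : x ∈ (fun x => x + a) ⁻¹' s := hx
      rw [Set.indicator_of_notMem h1, Set.indicator_of_mem h2,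
        exponentialPDF_of_neg (not_le.1 h0), mul_zero]
  · have h1 : x + a ∉ s ∩ Set.Ici a := fun h => hx h.1
    have h2 : x ∉ (fun x => x + a) ⁻¹' s := hx
    rw [Set.indicator_of_notMem h1, Set.indicator_of_notMem h2, mul_zero]

theorem lintegral_expMeasure_exp {r s : ℝ} (hr : 0 < r) (hs : 0 ≤ s) :
    ∫⁻ a, ENNReal.ofReal (Real.exp (-(s * a))) ∂(expMeasure r) = ENNReal.ofReal (r / (r + s)) := by
  have hrs : 0 < r + s := by linarith
  have hm : Measurable fun a : ℝ => ENNReal.ofReal (Real.exp (-(s * a))) := by fun_prop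
  rw [expMeasure_eq_withDensity,
    lintegral_withDensity_eq_lintegral_mul _ (measurable_exponentialPDF r) hm]
  have : ∀ a, (exponentialPDF r * fun a : ℝ => ENNReal.ofReal (Real.exp (-(s * a)))) a =
      ENNReal.ofReal (r / (r + s)) * exponentialPDF (r + s) a := by
    intro a
    rw [Pi.mul_apply]
    by_cases h0 : 0 ≤ a
    · rw [exponentialPDF_of_nonneg h0, exponentialPDF_of_nonneg h0,
        ← ENNReal.ofReal_mul (by positivity), ← ENNReal.ofReal_mul (by positivity)]
      congr 1
      rw [mul_assoc, ← Real.exp_add]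
      field_simp
      congr 1
      ring
    · simp [exponentialPDF_of_neg (not_le.1 h0)]
  rw [lintegral_congr this, lintegral_const_mul _ (measurable_exponentialPDF _),
    lintegral_exponentialPDF_eq_one hrs, mul_one]

theorem ae_expMeasure_nonneg (r : ℝ) : ∀ᵐ a ∂(expMeasure r), 0 ≤ a := by
  rw [ae_iff]
  have : {a : ℝ | ¬ 0 ≤ a} = Set.Iio 0 := by ext; simp
  rw [this, expMeasure_eq_withDensity, withDensity_apply _ measurableSet_Iio]
  exact lintegral_exponentialPDF_of_nonpos le_rfl

theorem expMeasure_singleton (r a : ℝ) : expMeasure r {a} = 0 :=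
  withDensity_absolutelyContinuous _ _ (by simp)

open Classical in
/-- Advance the clocks in `S` by `a`. -/
noncomputable def shift {V : Type*} (S : Finset V) (a : ℝ) (t : V → ℝ) : V → ℝ :=
  fun v => if v ∈ S then t v + a else t v

theorem measurable_shift {V : Type*} (S : Finset V) (a : ℝ) : Measurable (shift S a) := by
  refine measurable_pi_lambda _ fun v => ?_
  unfold shift
  split_ifs <;> fun_prop

variable {V : Type*} [Fintype V]

/-- The joint law of independent exponential clocks with rates `r`. -/
noncomputable def clockLaw (r : V → ℝ) : Measure (V → ℝ) := Measure.pi fun v => expMeasure (r v)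

theorem isProbabilityMeasure_clockLaw {r : V → ℝ} (hr : ∀ v, 0 < r v) :
    IsProbabilityMeasure (clockLaw r) := by
  have := fun v => isProbabilityMeasure_expMeasure (hr v)
  unfold clockLaw
  infer_instance

/-- Resampling one clock does not change the joint law. -/
theorem lintegral_clockLaw_update [DecidableEq V] {r : V → ℝ} (hr : ∀ v, 0 < r v) (i : V)
    {f : (V → ℝ) → ℝ≥0∞} (hf : Measurable f) :
    ∫⁻ t, f t ∂(clockLaw r) =
      ∫⁻ t, ∫⁻ a, f (Function.update t i a) ∂(expMeasure (r i)) ∂(clockLaw r) := by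
  have := fun v => isProbabilityMeasure_expMeasure (hr v)
  have h := lmarginal_singleton (μ := fun v => expMeasure (r v)) f i
  have hg : Measurable (∫⋯∫⁻_{i}, f ∂fun v => expMeasure (r v)) := hf.lmarginal _
  -- The marginal of `f` over coordinate `i` no longer depends on that coordinate, so integrating it
  -- out once more changes nothing.
  have := lintegral_eq_of_lmarginal_eq (μ := fun v => expMeasure (r v)) {i} hf hg (by
    rw [lmarginal_singleton (μ := fun v => expMeasure (r v))
      (∫⋯∫⁻_{i}, f ∂fun v => expMeasure (r v)) i]
    funext x
    have h2 : ∀ a, (∫⋯∫⁻_{i}, f ∂fun v => expMeasure (r v)) (Function.update x i a) =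
        (∫⋯∫⁻_{i}, f ∂fun v => expMeasure (r v)) x := fun a =>
      lmarginal_update_of_mem _ (Finset.mem_singleton_self i) f x a
    simp [h2])
  rw [h] at this
  exact this

/-- Almost surely all clocks are distinct. -/
theorem ae_injective_clockLaw {r : V → ℝ} (hr : ∀ v, 0 < r v) :
    ∀ᵐ t ∂(clockLaw r), Function.Injective t := by
  classical
  have key : ∀ u w : V, u ≠ w → ∀ᵐ t ∂(clockLaw r), t u ≠ t w := by
    intro u w huw
    have hms : MeasurableSet {t : V → ℝ | t u = t w} :=
      measurableSet_eq_fun (measurable_pi_apply u) (measurable_pi_apply w)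
    rw [ae_iff]
    simp only [ne_eq, not_not]
    rw [← lintegral_indicator_one hms, lintegral_clockLaw_update hr u
      (measurable_one.indicator hms)]
    have : ∀ t : V → ℝ, ∫⁻ a, {t : V → ℝ | t u = t w}.indicator 1 (Function.update t u a)
        ∂(expMeasure (r u)) = 0 := by
      intro t
      have h1 : (fun a => {t : V → ℝ | t u = t w}.indicator (1 : (V → ℝ) → ℝ≥0∞)
          (Function.update t u a)) = ({t w} : Set ℝ).indicator 1 := by
        funext a
        simp [Set.indicator_apply, Function.update_of_ne huw.symm]
      rw [h1, lintegral_indicator_one (measurableSet_singleton _),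
        expMeasure_singleton]
    simp [this]
  have : ∀ᵐ t ∂(clockLaw r), ∀ u w : V, u ≠ w → t u ≠ t w := by
    rw [ae_all_iff]; intro u
    rw [ae_all_iff]; intro w
    by_cases huw : u = w
    · exact Filter.Eventually.of_forall fun t h => (h huw).elim
    · exact (key u w huw).mono fun t ht _ => ht
  filter_upwards [this] with t ht u w h
  by_contra hne
  exact ht u w hne h

/-- Given that all clocks in `S` are at least `a`, the law of the clocks is the original law with
these clocks advanced by `a`. -/
theorem clockLaw_restrict {r : V → ℝ} (hr : ∀ v, 0 < r v) (S : Finset V) {a : ℝ} (ha : 0 ≤ a) :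
    (clockLaw r).restrict {t | ∀ u ∈ S, a ≤ t u} =
      ENNReal.ofReal (Real.exp (-((∑ u ∈ S, r u) * a))) • (clockLaw r).map (shift S a) := by
  classical
  have := fun v => isProbabilityMeasure_expMeasure (hr v)
  have hset : {t : V → ℝ | ∀ u ∈ S, a ≤ t u} =
      Set.univ.pi fun v => if v ∈ S then Set.Ici a else Set.univ := by
    ext t
    simp only [Set.mem_ofPred_eq, Set.mem_pi, Set.mem_univ, true_implies]
    refine forall_congr' fun v => ?_
    split_ifs with h <;> simp [h]
  unfold clockLaw
  rw [hset, Measure.restrict_pi_pi]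
  refine Measure.pi_eq fun s hs => ?_
  have hpre : shift S a ⁻¹' (Set.univ.pi s) =
      Set.univ.pi fun v => if v ∈ S then (· + a) ⁻¹' s v else s v := by
    ext t
    simp only [Set.mem_preimage, Set.mem_pi, Set.mem_univ, true_implies, shift]
    refine forall_congr' fun v => ?_
    split_ifs with h <;> simp
  rw [Measure.smul_apply, Measure.map_apply (measurable_shift S a) (MeasurableSet.univ_pi hs),
    hpre, Measure.pi_pi, smul_eq_mul]
  have hv : ∀ v, ((expMeasure (r v)).restrict (if v ∈ S then Set.Ici a else Set.univ)) (s v) =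
      (if v ∈ S then ENNReal.ofReal (Real.exp (-(r v * a))) else 1) *
        expMeasure (r v) (if v ∈ S then (· + a) ⁻¹' s v else s v) := by
    intro v
    split_ifs with h
    · rw [expMeasure_restrict_Ici ha, Measure.smul_apply,
        Measure.map_apply (measurable_add_const a) (hs v), smul_eq_mul]
    · rw [Measure.restrict_univ, one_mul]
  rw [Finset.prod_congr rfl fun v _ => hv v, Finset.prod_mul_distrib]
  congr 1
  rw [Finset.prod_ite_mem, Finset.univ_inter, Finset.sum_mul, ← Finset.sum_neg_distrib,
    Real.exp_sum, ENNReal.ofReal_prod_of_nonneg fun _ _ => (Real.exp_pos _).le]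

/-- If an event is invariant under resampling clock `i` and under advancing all clocks in `S`, then
it is independent of the event that clock `i` rings before all clocks in `S`. -/
theorem clockLaw_inter_first {r : V → ℝ} (hr : ∀ v, 0 < r v) {i : V} {S : Finset V} (hi : i ∉ S)
    {E : Set (V → ℝ)} (hE : MeasurableSet E)
    (hupd : ∀ t t' : V → ℝ, (∀ v, v ≠ i → t v = t' v) → (t ∈ E ↔ t' ∈ E))
    (hshift : ∀ t a, shift S a t ∈ E ↔ t ∈ E) :
    (clockLaw r).real ({t | ∀ u ∈ S, t i ≤ t u} ∩ E) =
      r i / (r i + ∑ u ∈ S, r u) * (clockLaw r).real E := by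
  classical
  have := fun v => isProbabilityMeasure_expMeasure (hr v)
  have := isProbabilityMeasure_clockLaw hr
  have hS : 0 ≤ ∑ u ∈ S, r u := Finset.sum_nonneg fun u _ => (hr u).le
  have hms : MeasurableSet {t : V → ℝ | ∀ u ∈ S, t i ≤ t u} := by
    have : {t : V → ℝ | ∀ u ∈ S, t i ≤ t u} = ⋂ u ∈ S, {t : V → ℝ | t i ≤ t u} := by ext; simp
    rw [this]
    exact Finset.measurableSet_biInter _ fun u _ =>
      measurableSet_le (measurable_pi_apply i) (measurable_pi_apply u)
  have hms' : MeasurableSet {p : (V → ℝ) × ℝ | (∀ u ∈ S, p.2 ≤ p.1 u) ∧ p.1 ∈ E} := by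
    have : {p : (V → ℝ) × ℝ | (∀ u ∈ S, p.2 ≤ p.1 u) ∧ p.1 ∈ E} =
        (⋂ u ∈ S, {p : (V → ℝ) × ℝ | p.2 ≤ p.1 u}) ∩ Prod.fst ⁻¹' E := by ext; simp
    rw [this]
    refine (Finset.measurableSet_biInter _ fun u _ => measurableSet_le measurable_snd ?_).inter
      (measurable_fst hE)
    exact (measurable_pi_apply u).comp measurable_fst
  have hind : ∀ (t : V → ℝ) (a : ℝ),
      ({t : V → ℝ | ∀ u ∈ S, t i ≤ t u} ∩ E).indicator (1 : (V → ℝ) → ℝ≥0∞)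
        (Function.update t i a) =
      {p : (V → ℝ) × ℝ | (∀ u ∈ S, p.2 ≤ p.1 u) ∧ p.1 ∈ E}.indicator 1 (t, a) := by
    intro t a
    have h1 : Function.update t i a ∈ E ↔ t ∈ E :=
      hupd _ _ fun v hv => Function.update_of_ne hv _ _
    have h2 : ∀ u ∈ S, Function.update t i a u = t u := fun u hu =>
      Function.update_of_ne (ne_of_mem_of_not_mem hu hi) _ _
    have h3 : (∀ u ∈ S, Function.update t i a i ≤ Function.update t i a u) ↔
        ∀ u ∈ S, a ≤ t u := by
      refine forall₂_congr fun u hu => ?_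
      rw [h2 u hu, Function.update_self]
    simp only [Set.indicator_apply, Set.mem_inter_iff, Set.mem_ofPred_eq, h1, h3, Pi.one_apply]
  -- Fix the ringing time `a` of clock `i`. The clocks in `S` all survive until `a` with the
  -- exponential probability, and given this they are merely advanced by `a`, which `E` does not
  -- notice. Integrating over `a` then gives the ratio of rates.
  have hslice : ∀ a, 0 ≤ a →
      clockLaw r {t | (∀ u ∈ S, a ≤ t u) ∧ t ∈ E} =
        ENNReal.ofReal (Real.exp (-((∑ u ∈ S, r u) * a))) * clockLaw r E := by
    intro a ha
    have h1 : {t | (∀ u ∈ S, a ≤ t u) ∧ t ∈ E} = E ∩ {t : V → ℝ | ∀ u ∈ S, a ≤ t u} := by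
      ext; simp [and_comm]
    have h2 : shift S a ⁻¹' E = E := by ext t; exact hshift t a
    rw [h1, ← Measure.restrict_apply hE, clockLaw_restrict hr S ha, Measure.smul_apply,
      Measure.map_apply (measurable_shift S a) hE, h2, smul_eq_mul]
  have main : clockLaw r ({t | ∀ u ∈ S, t i ≤ t u} ∩ E) =
      ENNReal.ofReal (r i / (r i + ∑ u ∈ S, r u)) * clockLaw r E := by
    rw [← lintegral_indicator_one (hms.inter hE), lintegral_clockLaw_update hr i
      (measurable_one.indicator (hms.inter hE))]
    simp_rw [hind]
    rw [lintegral_lintegral_swap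
      (f := fun t a => {p : (V → ℝ) × ℝ | (∀ u ∈ S, p.2 ≤ p.1 u) ∧ p.1 ∈ E}.indicator 1 (t, a))
      (measurable_one.indicator hms').aemeasurable]
    rw [← lintegral_expMeasure_exp (hr i) hS, ← lintegral_mul_const _ (by fun_prop)]
    refine lintegral_congr_ae ?_
    filter_upwards [ae_expMeasure_nonneg (r i)] with a ha
    rw [← hslice a ha]
    exact lintegral_indicator_one (measurable_prodMk_right (y := a) hms')
  rw [measureReal_def, main, ENNReal.toReal_mul, ENNReal.toReal_ofReal
    (div_nonneg (hr i).le (by linarith [hr i])), measureReal_def]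

end Clocks

/-! ### Walks, exposed clocks and the probability of one step -/

section Paths

variable {V : Type*} [Fintype V]

open Classical in
/-- The neighbours of a vertex, as a finset. -/
noncomputable def nbrs (G : SimpleGraph V) (v : V) : Finset V := Finset.univ.filter (G.Adj v)

theorem mem_nbrs {G : SimpleGraph V} {v u : V} : u ∈ nbrs G v ↔ G.Adj v u := by
  simp [nbrs]

/-- The event that the listed vertices, read from the end of the list, form a walk in which every
vertex is followed by its neighbour with the smallest clock. -/
def pathEvent (G : SimpleGraph V) : List V → Set (V → ℝ)
  | [] => Set.univ
  | [_] => Set.univ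
  | w :: v :: L => {t | ∀ u ∈ nbrs G v, t w ≤ t u} ∩ pathEvent G (v :: L)

open Classical in
/-- The vertices whose clocks are inspected when moving on from the vertices at even positions. -/
noncomputable def exposed (G : SimpleGraph V) : List V → Finset V
  | [] => ∅
  | [v] => nbrs G v
  | v :: _ :: L => nbrs G v ∪ exposed G L

/-- The list, read from its end, is a walk in which every vertex is new: no vertex is a neighbour
of an earlier vertex other than its predecessor. -/
def IsFreshWalk (G : SimpleGraph V) : List V → Prop
  | [] => True
  | [_] => True
  -- The head of `L` is the predecessor of `v`, on the side of `w`; the tail starts with the vertex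
  -- before it, on the side of `v`. So `exposed G L.tail` collects the neighbours of the vertices on
  -- the side of `v` that precede `v`.
  | w :: v :: L => G.Adj v w ∧ w ∉ exposed G L.tail ∧ IsFreshWalk G (v :: L)

variable {G : SimpleGraph V}

theorem IsFreshWalk.of_cons : ∀ {v : V} {L : List V}, IsFreshWalk G (v :: L) → IsFreshWalk G L
  | _, [], _ => trivial
  | _, _ :: _, h => h.2.2

theorem mem_exposed_cons_cons {v a u : V} {L : List V} :
    u ∈ exposed G (v :: a :: L) ↔ u ∈ nbrs G v ∨ u ∈ exposed G L := by
  simp [exposed]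

theorem exposed_pair (v a : V) : exposed G [v, a] = nbrs G v := by
  ext u
  rw [mem_exposed_cons_cons]
  simp [exposed]

theorem nbrs_subset_exposed_cons : ∀ (v : V) (L : List V), nbrs G v ⊆ exposed G (v :: L)
  | _, [] => Finset.Subset.refl _
  | _, _ :: _ => fun _ hu => mem_exposed_cons_cons.2 (Or.inl hu)

/-- The predecessor `a` of `v` is itself a candidate for the step out of `v`, so `w` rings no later
than `a`; inductively `a` rings no later than anything exposed before. -/
theorem head_le_of_mem_pathEvent {t : V → ℝ} : ∀ {w v : V} {L : List V},
    IsFreshWalk G (w :: v :: L) → t ∈ pathEvent G (w :: v :: L) →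
    ∀ u ∈ exposed G (v :: L), t w ≤ t u
  | _, _, [], _, h, u, hu => h.1 u hu
  | _, _, [_], _, h, u, hu => by
    rw [exposed_pair] at hu
    exact h.1 u hu
  | w, v, a :: b :: L, hw, h, u, hu => by
    rw [mem_exposed_cons_cons] at hu
    rcases hu with hu | hu
    · exact h.1 u hu
    · exact (h.1 a (mem_nbrs.2 hw.2.2.1.symm)).trans
        (head_le_of_mem_pathEvent hw.2.2.2.2 h.2.2 u hu)

/-- The event compares only clocks of neighbours of a common vertex, so it is unaffected if each
such neighbourhood is translated as a whole. The constant may vary with the vertex. -/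
theorem mem_pathEvent_congr {t t' : V → ℝ} : ∀ {L : List V}, IsFreshWalk G L →
    (∀ b ∈ L.tail, ∃ c, ∀ u ∈ nbrs G b, t' u = t u + c) →
    (t' ∈ pathEvent G L ↔ t ∈ pathEvent G L)
  | [], _, _ => Iff.rfl
  | [_], _, _ => Iff.rfl
  | w :: v :: L, hL, h => by
    have ih := mem_pathEvent_congr hL.2.2 fun b hb => h b (List.mem_cons_of_mem _ hb)
    obtain ⟨c, hc⟩ := h v List.mem_cons_self
    refine and_congr ?_ ih
    refine forall₂_congr fun u hu => ?_
    rw [hc u hu, hc w (mem_nbrs.2 hL.1), add_le_add_iff_right]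

theorem measurableSet_pathEvent : ∀ L : List V, MeasurableSet (pathEvent G L)
  | [] => MeasurableSet.univ
  | [_] => MeasurableSet.univ
  | w :: v :: L => by
    have : {t : V → ℝ | ∀ u ∈ nbrs G v, t w ≤ t u} =
        ⋂ u ∈ nbrs G v, {t : V → ℝ | t w ≤ t u} := by ext; simp
    refine MeasurableSet.inter ?_ (measurableSet_pathEvent (v :: L))
    rw [this]
    exact Finset.measurableSet_biInter _ fun u _ =>
      measurableSet_le (measurable_pi_apply w) (measurable_pi_apply u)

theorem side_ne_of_mem_exposed {s : V → Bool} (hs : ∀ u v, G.Adj u v → s u ≠ s v) :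
    ∀ {v : V} {L : List V}, IsFreshWalk G (v :: L) →
    ∀ u ∈ exposed G (v :: L), s v ≠ s u
  | _, [], _, u, hu => hs _ _ (mem_nbrs.1 hu)
  | _, [_], _, u, hu => by
    rw [exposed_pair] at hu
    exact hs _ _ (mem_nbrs.1 hu)
  | v, a :: b :: L, h, u, hu => by
    rw [mem_exposed_cons_cons] at hu
    rcases hu with hu | hu
    · exact hs _ _ (mem_nbrs.1 hu)
    · have h1 := side_ne_of_mem_exposed hs h.2.2.2.2 u hu
      have h2 := hs _ _ h.1
      have h3 := hs _ _ h.2.2.1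
      revert h1 h2 h3
      cases s a <;> cases s b <;> cases s v <;> simp

/-- `exposed` takes every second vertex of the list; by bipartiteness these are exactly the vertices
on the side of the head. -/
theorem nbrs_subset_exposed {s : V → Bool} (hs : ∀ u v, G.Adj u v → s u ≠ s v) :
    ∀ {v : V} {L : List V}, IsFreshWalk G (v :: L) →
    ∀ b ∈ v :: L, s b = s v → nbrs G b ⊆ exposed G (v :: L)
  | _, [], _, b, hb, _ => by
    rw [List.mem_singleton] at hb
    rw [hb]; exact nbrs_subset_exposed_cons _ _
  | v, [a], h, b, hb, hside => by
    rcases List.mem_cons.1 hb with rfl | hb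
    · exact nbrs_subset_exposed_cons _ _
    · rw [List.mem_singleton] at hb
      exact (hs _ _ h.1 (hb ▸ hside)).elim
  | v, a :: c :: L, h, b, hb, hside => by
    rcases List.mem_cons.1 hb with rfl | hb
    · exact nbrs_subset_exposed_cons _ _
    · rcases List.mem_cons.1 hb with rfl | hb
      · exact (hs _ _ h.1 hside).elim
      · have h2 := hs _ _ h.1
        have h3 := hs _ _ h.2.2.1
        have hcv : s b = s c := by
          revert h2 h3 hside
          cases s a <;> cases s b <;> cases s c <;> cases s v <;> simp
        exact (nbrs_subset_exposed hs h.2.2.2.2 b hb hcv).trans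
          fun _ hu => mem_exposed_cons_cons.2 (Or.inr hu)

/-- The probability that a walk continues to a given fresh vertex. -/
theorem clockLaw_pathEvent_cons_le {s : V → Bool} (hs : ∀ u v, G.Adj u v → s u ≠ s v)
    {r : V → ℝ} (hr : ∀ v, 0 < r v) {w v : V} {L : List V}
    (h : IsFreshWalk G (w :: v :: L)) :
    (clockLaw r).real (pathEvent G (w :: v :: L)) ≤
      r w / (∑ u ∈ exposed G (v :: L), r u) * (clockLaw r).real (pathEvent G (v :: L)) := by
  classical
  have := isProbabilityMeasure_clockLaw hr
  have hw : w ∈ exposed G (v :: L) := nbrs_subset_exposed_cons _ _ (mem_nbrs.2 h.1)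
  have hwv : s v ≠ s w := hs _ _ h.1
  -- Such a `b` would lie on the side of `v`, hence be neither the predecessor of `v` nor a vertex
  -- excluded by freshness.
  have hwL : ∀ b ∈ L, w ∉ nbrs G b := by
    intro b hb hwb
    have hbw := hs _ _ (mem_nbrs.1 hwb)
    have hbv : s b = s v := by
      revert hbw hwv; cases s b <;> cases s v <;> cases s w <;> simp
    match L, h, hb with
    | [a], h, hb =>
      rw [List.mem_singleton] at hb
      exact hs _ _ h.2.2.1 (hb ▸ hbv)
    | a :: c :: L, h, hb =>
      rcases List.mem_cons.1 hb with rfl | hb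
      · exact hs _ _ h.2.2.1 hbv
      · have h2 := hs _ _ h.2.2.1
        have h3 := hs _ _ h.2.2.2.2.1
        have hcv : s b = s c := by
          revert h2 h3 hbv
          cases s a <;> cases s b <;> cases s c <;> cases s v <;> simp
        exact h.2.1 (nbrs_subset_exposed hs h.2.2.2.2.2.2 b hb hcv hwb)
  have hsum : r w + ∑ u ∈ (exposed G (v :: L)).erase w, r u = ∑ u ∈ exposed G (v :: L), r u :=
    Finset.add_sum_erase _ _ hw
  -- The longer walk forces `w` to ring first among all exposed clocks, not only among the
  -- neighbours of `v`. The event of the shorter walk never looks at the clock of `w`, and it is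
  -- invariant when the other exposed clocks advance: neighbourhoods of vertices on the side of `v`
  -- move by `a`, those on the other side do not move.
  rw [← hsum, ← clockLaw_inter_first hr (Finset.notMem_erase w _) (measurableSet_pathEvent _)]
  · refine measureReal_mono fun t ht => ⟨fun u hu => ?_, ht.2⟩
    exact head_le_of_mem_pathEvent h ht u (Finset.mem_of_mem_erase hu)
  · intro t t' htt
    refine mem_pathEvent_congr h.2.2 fun b hb => ⟨0, fun u hu => ?_⟩
    rw [htt u (ne_of_mem_of_not_mem hu (hwL b hb)), add_zero]
  · intro t a
    refine mem_pathEvent_congr h.2.2 fun b hb => ?_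
    by_cases hbv : s b = s v
    · refine ⟨a, fun u hu => if_pos (Finset.mem_erase.2 ⟨?_, ?_⟩)⟩
      · exact ne_of_mem_of_not_mem hu (hwL b hb)
      · exact nbrs_subset_exposed hs h.2.2 b (List.mem_cons_of_mem _ hb) hbv hu
    · refine ⟨0, fun u hu => ?_⟩
      rw [add_zero]
      refine if_neg fun hu' => ?_
      have h1 := side_ne_of_mem_exposed hs h.2.2 u (Finset.mem_of_mem_erase hu')
      have h2 := hs _ _ (mem_nbrs.1 hu)
      revert h1 h2 hbv
      cases s b <;> cases s u <;> cases s v <;> simp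

end Paths

/-! ### Summing the probabilities of all walks into a client -/

section Weights

/-- The lists of a given length over a finite type. -/
noncomputable def listsOfLength (V : Type*) [Finite V] (n : ℕ) : Finset (List V) :=
  (List.finite_length_eq V n).toFinset

theorem mem_listsOfLength {V : Type*} [Finite V] {n : ℕ} {L : List V} :
    L ∈ listsOfLength V n ↔ L.length = n := by
  simp [listsOfLength]

theorem sum_listsOfLength_zero {V : Type*} [Finite V] (f : List V → ℝ) :
    ∑ L ∈ listsOfLength V 0, f L = f [] := by
  have : listsOfLength V 0 = {[]} := by ext L; simp [mem_listsOfLength]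
  rw [this, Finset.sum_singleton]

variable {V : Type*} [Fintype V]

theorem sum_listsOfLength_succ (n : ℕ) (f : List V → ℝ) :
    ∑ L ∈ listsOfLength V (n + 1), f L = ∑ a, ∑ L ∈ listsOfLength V n, f (a :: L) := by
  rw [← Finset.sum_product']
  symm
  refine Finset.sum_bij (fun p _ => p.1 :: p.2) ?_ ?_ ?_ fun _ _ => rfl
  · intro p hp
    rw [Finset.mem_product, mem_listsOfLength] at hp
    rw [mem_listsOfLength, List.length_cons, hp.2]
  · rintro ⟨a, L⟩ _ ⟨b, M⟩ _ h
    simpa using h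
  · intro L hL
    rw [mem_listsOfLength] at hL
    obtain ⟨a, M, rfl⟩ := List.exists_cons_of_length_eq_add_one hL
    refine ⟨(a, M), ?_, rfl⟩
    rw [Finset.mem_product, mem_listsOfLength]
    exact ⟨Finset.mem_univ _, by simpa using hL⟩

theorem sum_listsOfLength_add_two (n : ℕ) (f : List V → ℝ) :
    ∑ L ∈ listsOfLength V (n + 2), f L =
      ∑ a, ∑ b, ∑ L ∈ listsOfLength V n, f (a :: b :: L) := by
  rw [sum_listsOfLength_succ]
  exact Finset.sum_congr rfl fun a _ => sum_listsOfLength_succ n _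

/-- The total rate of the neighbours of `X` that are not neighbours of `Z`. -/
noncomputable def newRate (G : SimpleGraph V) (r : V → ℝ) (Z X : V) : ℝ :=
  open Classical in ∑ u ∈ nbrs G X \ nbrs G Z, r u

open Classical in
/-- The weight of the step to a facility `Y` of `T`, followed by the step to its client `X'`. -/
noncomputable def stepWeight (G : SimpleGraph V) (r : V → ℝ) (T : Finset V) (Y X' : V) : ℝ :=
  if Y ∈ T ∧ X' ∈ nbrs G Y then r Y / (nbrs G Y).card else 0

open Classical in
/-- The weight of a continuation of a walk whose last two clients are `Z` and `X`. -/
noncomputable def walkWeight (G : SimpleGraph V) (r : V → ℝ) : V → V → List V → ℝ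
  | _, _, [] => 1
  | _, _, [_] => 1
  | Z, X, Y :: X' :: L =>
    -- The denominator bounds the rate exposed when the walk leaves `Z`, not `X`. Paired this way,
    -- summing over `Y` produces the same `newRate` in the numerator.
    stepWeight G r (nbrs G X \ nbrs G Z) Y X' / (1 + newRate G r Z X) * walkWeight G r X X' L

open Classical in
/-- The probability of a walk to the client `k`, or zero if the walk is not fresh. -/
noncomputable def walkProb (G : SimpleGraph V) (r : V → ℝ) (k : V) (L : List V) : ℝ :=
  if IsFreshWalk G (k :: L) then (clockLaw r).real (pathEvent G (k :: L)) else 0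

/-- The properties of the support graph and the rates that are used: the graph is bipartite, with
sides facilities and clients (`s v = true`), every client has rate one, and the facilities adjacent
to a client have total rate one. -/
structure IsInstance (G : SimpleGraph V) (r : V → ℝ) (s : V → Bool) : Prop where
  pos : ∀ v, 0 < r v
  side_ne : ∀ u v, G.Adj u v → s u ≠ s v
  client : ∀ v, s v = true → r v = 1
  sum_nbrs : ∀ v, s v = true → ∑ u ∈ nbrs G v, r u = 1

variable {G : SimpleGraph V} {r : V → ℝ} {s : V → Bool}

theorem stepWeight_nonneg (hr : ∀ v, 0 < r v) (T : Finset V) (Y X' : V) :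
    0 ≤ stepWeight G r T Y X' := by
  unfold stepWeight
  split_ifs
  · have := hr Y
    positivity
  · exact le_rfl

theorem newRate_nonneg (hr : ∀ v, 0 < r v) (Z X : V) : 0 ≤ newRate G r Z X :=
  Finset.sum_nonneg fun u _ => (hr u).le

theorem walkWeight_nonneg (hr : ∀ v, 0 < r v) : ∀ (Z X : V) (L : List V),
    0 ≤ walkWeight G r Z X L
  | _, _, [] => zero_le_one
  | _, _, [_] => zero_le_one
  | Z, X, Y :: X' :: L => by
    have h1 := newRate_nonneg (G := G) hr Z X
    exact mul_nonneg (div_nonneg (stepWeight_nonneg hr _ _ _) (by linarith))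
      (walkWeight_nonneg hr X X' L)

namespace IsInstance

theorem side_eq (h : IsInstance G r s) {X Y X' : V} (hX : s X = true) (h1 : G.Adj X Y)
    (h2 : G.Adj Y X') : s X' = true := by
  have h3 := h.side_ne _ _ h1
  have h4 := h.side_ne _ _ h2
  revert h3 h4 hX
  cases s X <;> cases s Y <;> cases s X' <;> simp

/-- The weight of `Y` is split evenly among its neighbours, so summing over `X'` returns the full
rate of `Y`. -/
theorem sum_stepWeight_le (h : IsInstance G r s) {X : V} (hX : s X = true) {T : Finset V}
    (hT : T ⊆ nbrs G X) {g : V → V → ℝ} {c : ℝ}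
    (hg : ∀ Y X', s X' = true → g Y X' ≤ c) :
    ∑ Y, ∑ X', stepWeight G r T Y X' * g Y X' ≤ (∑ Y ∈ T, r Y) * c := by
  classical
  have h1 : ∀ Y X', stepWeight G r T Y X' * g Y X' ≤
      if Y ∈ T then (if X' ∈ nbrs G Y then r Y / (nbrs G Y).card * c else 0) else 0 := by
    intro Y X'
    unfold stepWeight
    by_cases hY : Y ∈ T
    · by_cases hX' : X' ∈ nbrs G Y
      · rw [if_pos ⟨hY, hX'⟩, if_pos hY, if_pos hX']
        refine mul_le_mul_of_nonneg_left (hg _ _ ?_) (div_nonneg (h.pos Y).le (Nat.cast_nonneg _))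
        exact h.side_eq hX (mem_nbrs.1 (hT hY)) (mem_nbrs.1 hX')
      · rw [if_neg fun h => hX' h.2, if_pos hY, if_neg hX', zero_mul]
    · rw [if_neg fun h => hY h.1, if_neg hY, zero_mul]
  calc ∑ Y, ∑ X', stepWeight G r T Y X' * g Y X'
      ≤ ∑ Y, ∑ X', if Y ∈ T then
          (if X' ∈ nbrs G Y then r Y / (nbrs G Y).card * c else 0) else 0 :=
        Finset.sum_le_sum fun Y _ => Finset.sum_le_sum fun X' _ => h1 Y X'
    _ ≤ ∑ Y, if Y ∈ T then r Y * c else 0 := by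
        refine Finset.sum_le_sum fun Y _ => ?_
        by_cases hY : Y ∈ T
        · simp only [if_pos hY]
          rw [← Finset.sum_filter, Finset.sum_const, nsmul_eq_mul]
          have hf : (Finset.univ.filter fun X' => X' ∈ nbrs G Y) = nbrs G Y := by ext; simp
          rw [hf]
          have hpos : (0 : ℝ) < (nbrs G Y).card := by
            have : X ∈ nbrs G Y := mem_nbrs.2 (mem_nbrs.1 (hT hY)).symm
            exact_mod_cast Finset.card_pos.2 ⟨X, this⟩
          refine le_of_eq ?_
          field_simp
        · simp [if_neg hY]
    _ = (∑ Y ∈ T, r Y) * c := by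
        rw [← Finset.sum_filter, Finset.sum_mul]
        congr 1
        ext; simp

theorem newRate_le_one (h : IsInstance G r s) (Z : V) {X : V} (hX : s X = true) :
    newRate G r Z X ≤ 1 := by
  classical
  rw [← h.sum_nbrs X hX]
  exact Finset.sum_le_sum_of_subset_of_nonneg Finset.sdiff_subset fun u _ _ => (h.pos u).le

/-- Each round trip contributes D / (1 + D) with D = `newRate G r Z X` ≤ 1, hence at most 1/2. -/
theorem sum_walkWeight_le (h : IsInstance G r s) (n : ℕ) : ∀ Z X : V, s X = true →
    ∑ L ∈ listsOfLength V (2 * n), walkWeight G r Z X L ≤ (1 / 2) ^ n := by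
  classical
  induction n with
  | zero =>
    intro Z X _
    rw [mul_zero, sum_listsOfLength_zero]
    simp [walkWeight]
  | succ n ih =>
    intro Z X hX
    have hD := newRate_nonneg (G := G) h.pos Z X
    have hD1 := h.newRate_le_one Z hX
    rw [mul_add, mul_one, sum_listsOfLength_add_two]
    have h1 : ∀ Y X', ∑ L ∈ listsOfLength V (2 * n), walkWeight G r Z X (Y :: X' :: L) =
        (stepWeight G r (nbrs G X \ nbrs G Z) Y X' *
          ∑ L ∈ listsOfLength V (2 * n), walkWeight G r X X' L) * (1 + newRate G r Z X)⁻¹ := by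
      intro Y X'
      simp only [walkWeight]
      rw [← Finset.mul_sum]
      ring
    simp_rw [h1, ← Finset.sum_mul]
    have h2 := h.sum_stepWeight_le hX (T := nbrs G X \ nbrs G Z) Finset.sdiff_subset
      (g := fun _ X' => ∑ L ∈ listsOfLength V (2 * n), walkWeight G r X X' L)
      (c := (1 / 2) ^ n) fun Y X' hX' => ih X X' hX'
    have h3 : ∑ u ∈ nbrs G X \ nbrs G Z, r u = newRate G r Z X := by
      unfold newRate; congr
    rw [h3] at h2
    refine (mul_le_mul_of_nonneg_right h2 (by positivity)).trans ?_
    rw [← div_eq_mul_inv, div_le_iff₀ (by linarith), pow_succ]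
    have : (0 : ℝ) < (1 / 2) ^ n := by positivity
    nlinarith

/-- The probability of a walk that ends with the step to the client `X` via the facility `Y`. -/
theorem pathEvent_le (h : IsInstance G r s) {X Y X' : V} {L : List V} (hX : s X = true)
    (hw : IsFreshWalk G (X :: Y :: X' :: L)) :
    (clockLaw r).real (pathEvent G (X :: Y :: X' :: L)) ≤
      r Y / (nbrs G Y).card / (∑ u ∈ exposed G (X' :: L), r u) *
        (clockLaw r).real (pathEvent G (X' :: L)) := by
  have h1 := clockLaw_pathEvent_cons_le h.side_ne h.pos hw
  have h2 := clockLaw_pathEvent_cons_le h.side_ne h.pos hw.2.2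
  have hXY : X ∈ nbrs G Y := mem_nbrs.2 hw.1
  -- All neighbours of a facility are clients, of rate one.
  have hcard : ((nbrs G Y).card : ℝ) = ∑ u ∈ nbrs G Y, r u := by
    rw [Finset.sum_congr rfl fun u hu => h.client u
      (h.side_eq hX (mem_nbrs.1 hXY).symm (mem_nbrs.1 hu))]
    simp
  have hle : ((nbrs G Y).card : ℝ) ≤ ∑ u ∈ exposed G (Y :: X' :: L), r u := by
    rw [hcard]
    exact Finset.sum_le_sum_of_subset_of_nonneg (nbrs_subset_exposed_cons _ _)
      fun u _ _ => (h.pos u).le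
  have hpos : (0 : ℝ) < (nbrs G Y).card := by exact_mod_cast Finset.card_pos.2 ⟨X, hXY⟩
  rw [h.client X hX] at h1
  calc _ ≤ _ := h1
    _ ≤ 1 / ((nbrs G Y).card : ℝ) * (r Y / (∑ u ∈ exposed G (X' :: L), r u) *
        (clockLaw r).real (pathEvent G (X' :: L))) := by
        refine mul_le_mul ?_ h2 measureReal_nonneg (by positivity)
        exact one_div_le_one_div_of_le hpos hle
    _ = _ := by ring

theorem one_le_sum_exposed (h : IsInstance G r s) {X : V} (L : List V) (hX : s X = true) :
    1 ≤ ∑ u ∈ exposed G (X :: L), r u := by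
  rw [← h.sum_nbrs X hX]
  exact Finset.sum_le_sum_of_subset_of_nonneg (nbrs_subset_exposed_cons _ _)
    fun u _ _ => (h.pos u).le

/-- The neighbours of `X` have rate one and those of `X'` alone have rate `newRate G r X X'`; the
two sets are disjoint and both exposed. -/
theorem one_add_newRate_le (h : IsInstance G r s) {X Y X' : V} (L : List V) (hX : s X = true) :
    1 + newRate G r X X' ≤ ∑ u ∈ exposed G (X :: Y :: X' :: L), r u := by
  classical
  rw [← h.sum_nbrs X hX, newRate]
  rw [show ∑ u ∈ nbrs G X, r u + (open Classical in ∑ u ∈ nbrs G X' \ nbrs G X, r u) =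
    ∑ u ∈ nbrs G X, r u + ∑ u ∈ nbrs G X' \ nbrs G X, r u by congr]
  rw [← Finset.sum_union Finset.disjoint_sdiff]
  refine Finset.sum_le_sum_of_subset_of_nonneg ?_ fun u _ _ => (h.pos u).le
  intro u hu
  rw [mem_exposed_cons_cons]
  rcases Finset.mem_union.1 hu with hu | hu
  · exact Or.inl hu
  · exact Or.inr (nbrs_subset_exposed_cons _ _ (Finset.mem_sdiff.1 hu).1)

theorem stepWeight_eq {T : Finset V} {Y X' : V} (hY : Y ∈ T) (hX' : G.Adj Y X') :
    stepWeight G r T Y X' = r Y / (nbrs G Y).card :=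
  if_pos ⟨hY, mem_nbrs.2 hX'⟩

/-- The factor `1 + newRate G r X X'` compensates for the denominator that `walkWeight` already
charges for the step out of `X`; it cancels when the walk is prolonged beyond `X`. -/
theorem pathEvent_le_walkWeight (h : IsInstance G r s) : ∀ {X Y X' : V} {L : List V},
    s X = true → IsFreshWalk G (X :: Y :: X' :: L) →
    (clockLaw r).real (pathEvent G (X :: Y :: X' :: L)) ≤
      r Y / (nbrs G Y).card * ((1 + newRate G r X X') * walkWeight G r X X' L)
  | X, Y, X', L, hX, hw => by
    have := isProbabilityMeasure_clockLaw h.pos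
    have hD := newRate_nonneg (G := G) h.pos X X'
    have hq : 0 ≤ r Y / ((nbrs G Y).card : ℝ) := div_nonneg (h.pos Y).le (Nat.cast_nonneg _)
    have hX' : s X' = true := h.side_eq hX hw.1.symm hw.2.2.1.symm
    -- Base case: the exposed rate is at least one and the remaining probability at most one.
    have short : walkWeight G r X X' L = 1 →
        (clockLaw r).real (pathEvent G (X :: Y :: X' :: L)) ≤
          r Y / (nbrs G Y).card * ((1 + newRate G r X X') * walkWeight G r X X' L) := by
      intro h1
      rw [h1, mul_one]
      refine (h.pathEvent_le hX hw).trans ?_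
      rw [div_mul_eq_mul_div, mul_div_assoc]
      refine mul_le_mul_of_nonneg_left ?_ hq
      rw [div_le_iff₀ (by linarith [h.one_le_sum_exposed L hX'])]
      have h2 : (clockLaw r).real (pathEvent G (X' :: L)) ≤ 1 := measureReal_le_one
      nlinarith [h.one_le_sum_exposed L hX']
    match L, hw, short with
    | [], _, short => exact short rfl
    | [_], _, short => exact short rfl
    | Y₂ :: X₂ :: L, hw, _ =>
      have ih := h.pathEvent_le_walkWeight hX' hw.2.2.2.2
      have hD2 := newRate_nonneg (G := G) h.pos X' X₂
      have hadj : G.Adj Y₂ X₂ := hw.2.2.2.2.2.2.1.symm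
      have hmem : Y₂ ∈ nbrs G X' := mem_nbrs.2 hw.2.2.2.2.1.symm
      -- Freshness of `X`: it is not a neighbour of the earlier facility `Y₂`.
      have hnot : Y₂ ∉ nbrs G X := fun hc =>
        hw.2.1 (nbrs_subset_exposed_cons _ _ (mem_nbrs.2 (mem_nbrs.1 hc).symm))
      have hle := h.one_add_newRate_le (Y := Y₂) (X' := X₂) L hX'
      have hq2 : 0 ≤ r Y₂ / ((nbrs G Y₂).card : ℝ) :=
        div_nonneg (h.pos Y₂).le (Nat.cast_nonneg _)
      have hA := walkWeight_nonneg (G := G) h.pos X' X₂ L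
      classical
      rw [walkWeight, stepWeight_eq (Finset.mem_sdiff.2 ⟨hmem, hnot⟩) hadj]
      refine (h.pathEvent_le hX hw).trans ?_
      rw [div_mul_eq_mul_div, mul_div_assoc]
      refine mul_le_mul_of_nonneg_left ?_ hq
      rw [div_mul_eq_mul_div, mul_div_cancel₀ _ (by linarith), div_le_iff₀ (by linarith)]
      refine ih.trans ?_
      have := mul_le_mul_of_nonneg_right hle (mul_nonneg hq2 hA)
      linarith

theorem sum_walkProb_two_le (h : IsInstance G r s) {k : V} (hk : s k = true) :
    ∑ L ∈ listsOfLength V 2, walkProb G r k L ≤ 1 := by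
  have := isProbabilityMeasure_clockLaw h.pos
  rw [sum_listsOfLength_add_two]
  have h1 : ∀ Y X, ∑ L ∈ listsOfLength V 0, walkProb G r k (Y :: X :: L) ≤
      stepWeight G r (nbrs G k) Y X * 1 := by
    intro Y X
    rw [sum_listsOfLength_zero, walkProb, mul_one]
    split_ifs with hw
    · have hX : s X = true := h.side_eq hk hw.1.symm hw.2.2.1.symm
      refine (h.pathEvent_le hk hw).trans ?_
      rw [stepWeight_eq (mem_nbrs.2 hw.1.symm) hw.2.2.1.symm, exposed, h.sum_nbrs X hX, div_one]
      exact mul_le_of_le_one_right (div_nonneg (h.pos Y).le (Nat.cast_nonneg _)) measureReal_le_one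
    · exact stepWeight_nonneg h.pos _ _ _
  refine (Finset.sum_le_sum fun Y _ => Finset.sum_le_sum fun X _ => h1 Y X).trans ?_
  have := h.sum_stepWeight_le hk (Finset.Subset.refl _) (g := fun _ _ => 1) (c := 1)
    fun _ _ _ => le_rfl
  rwa [h.sum_nbrs k hk, one_mul] at this

/-- The two round trips nearest to `k` are each summed over all neighbours, of total rate one; the
exposed rate on leaving `X` cancels the factor from `pathEvent_le_walkWeight`. Only the remaining
`n` round trips gain 1/2 each. -/
theorem sum_walkProb_le (h : IsInstance G r s) {k : V} (hk : s k = true) (n : ℕ) :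
    ∑ L ∈ listsOfLength V (2 * n + 4), walkProb G r k L ≤ (1 / 2) ^ n := by
  rw [show 2 * n + 4 = (2 * n + 2) + 2 by ring, sum_listsOfLength_add_two]
  have h1 : ∀ Y X, ∑ L ∈ listsOfLength V (2 * n + 2), walkProb G r k (Y :: X :: L) ≤
      stepWeight G r (nbrs G k) Y X * ∑ Y₂, ∑ X₂, stepWeight G r (nbrs G X) Y₂ X₂ *
        ∑ L ∈ listsOfLength V (2 * n), walkWeight G r X X₂ L := by
    intro Y X
    rw [sum_listsOfLength_add_two, Finset.mul_sum]
    refine Finset.sum_le_sum fun Y₂ _ => ?_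
    rw [Finset.mul_sum]
    refine Finset.sum_le_sum fun X₂ _ => ?_
    rw [Finset.mul_sum, Finset.mul_sum]
    refine Finset.sum_le_sum fun L _ => ?_
    have hA := walkWeight_nonneg (G := G) h.pos X X₂ L
    rw [walkProb]
    split_ifs with hw
    · have hX : s X = true := h.side_eq hk hw.1.symm hw.2.2.1.symm
      have hD := newRate_nonneg (G := G) h.pos X X₂
      have hq : 0 ≤ r Y / ((nbrs G Y).card : ℝ) := div_nonneg (h.pos Y).le (Nat.cast_nonneg _)
      have hq2 : 0 ≤ r Y₂ / ((nbrs G Y₂).card : ℝ) :=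
        div_nonneg (h.pos Y₂).le (Nat.cast_nonneg _)
      have hle := h.one_add_newRate_le (Y := Y₂) (X' := X₂) L hX
      have hev := h.pathEvent_le_walkWeight hX hw.2.2.2.2
      rw [stepWeight_eq (mem_nbrs.2 hw.1.symm) hw.2.2.1.symm,
        stepWeight_eq (mem_nbrs.2 hw.2.2.2.2.1.symm) hw.2.2.2.2.2.2.1.symm]
      refine (h.pathEvent_le hk hw).trans ?_
      rw [div_mul_eq_mul_div, mul_div_assoc]
      refine mul_le_mul_of_nonneg_left ?_ hq
      rw [div_le_iff₀ (by linarith)]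
      refine hev.trans ?_
      have := mul_le_mul_of_nonneg_right hle (mul_nonneg hq2 hA)
      linarith
    · exact mul_nonneg (stepWeight_nonneg h.pos _ _ _)
        (mul_nonneg (stepWeight_nonneg h.pos _ _ _) hA)
  refine (Finset.sum_le_sum fun Y _ => Finset.sum_le_sum fun X _ => h1 Y X).trans ?_
  have h2 : ∀ X, s X = true → ∑ Y₂, ∑ X₂, stepWeight G r (nbrs G X) Y₂ X₂ *
      ∑ L ∈ listsOfLength V (2 * n), walkWeight G r X X₂ L ≤ (1 / 2) ^ n := by
    intro X hX
    have := h.sum_stepWeight_le hX (Finset.Subset.refl _)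
      (g := fun _ X₂ => ∑ L ∈ listsOfLength V (2 * n), walkWeight G r X X₂ L)
      (c := (1 / 2) ^ n) fun _ X₂ hX₂ => h.sum_walkWeight_le n X X₂ hX₂
    rwa [h.sum_nbrs X hX, one_mul] at this
  have := h.sum_stepWeight_le hk (Finset.Subset.refl _)
      (g := fun _ X => ∑ Y₂, ∑ X₂, stepWeight G r (nbrs G X) Y₂ X₂ *
        ∑ L ∈ listsOfLength V (2 * n), walkWeight G r X X₂ L)
      (c := (1 / 2) ^ n) fun _ X hX => h2 X hX
  rwa [h.sum_nbrs k hk, one_mul] at this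

/-- The expected number of walks of positive length to a client is at most three. -/
theorem sum_sum_walkProb_le (h : IsInstance G r s) {k : V} (hk : s k = true) (N : ℕ) :
    ∑ l ∈ Finset.range N, ∑ L ∈ listsOfLength V (2 * (l + 1)), walkProb G r k L ≤ 3 := by
  have hgeom : ∀ n : ℕ, ∑ i ∈ Finset.range n, ((1 : ℝ) / 2) ^ i ≤ 2 := by
    intro n
    rw [geom_sum_eq (by norm_num)]
    have : (0 : ℝ) < (1 / 2) ^ n := by positivity
    rw [div_le_iff_of_neg (by norm_num)]
    linarith
  cases N with
  | zero => simp
  | succ N =>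
    -- Walks of length two are split off; the longer ones form the geometric series.
    rw [Finset.sum_range_succ']
    have h1 : ∑ l ∈ Finset.range N, ∑ L ∈ listsOfLength V (2 * (l + 1 + 1)), walkProb G r k L ≤
        ∑ l ∈ Finset.range N, (1 / 2) ^ l :=
      Finset.sum_le_sum fun l _ => h.sum_walkProb_le hk l
    have h2 : ∑ L ∈ listsOfLength V (2 * (0 + 1)), walkProb G r k L ≤ 1 :=
      h.sum_walkProb_two_le hk
    linarith [hgeom N]

end IsInstance

end Weights

/-! ### From visits to fresh walks -/

section Walks

/-- The values of a sequence before time `m`, latest first. -/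
def seqTail {V : Type*} (p : ℕ → V) : ℕ → List V
  | 0 => []
  | m + 1 => p m :: seqTail p m

theorem length_seqTail {V : Type*} (p : ℕ → V) : ∀ m, (seqTail p m).length = m
  | 0 => rfl
  | m + 1 => by rw [seqTail, List.length_cons, length_seqTail p m]

theorem getLast?_seqTail {V : Type*} (p : ℕ → V) :
    ∀ m, (seqTail p (m + 1)).getLast? = some (p 0)
  | 0 => rfl
  | m + 1 => by
    have := getLast?_seqTail p m
    rw [seqTail, List.getLast?_cons, this]
    rfl

variable {V : Type*} [Fintype V] {G : SimpleGraph V} {r : V → ℝ} {s : V → Bool} {t : V → ℝ}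

theorem mem_pathEvent_seqTail {p : ℕ → V} (hmin : ∀ m u, G.Adj (p m) u → t (p (m + 1)) ≤ t u) :
    ∀ m, t ∈ pathEvent G (p m :: seqTail p m)
  | 0 => trivial
  | m + 1 => ⟨fun u hu => hmin m u (mem_nbrs.1 hu), mem_pathEvent_seqTail hmin m⟩

/-- If a vertex had been exposed earlier, the vertex two steps before it would ring no later; but
that vertex was also a candidate for the last step. So the clocks tie, and the walk would have
returned to it. -/
theorem isFreshWalk_seqTail (ht : Function.Injective t) {p : ℕ → V}
    (hadj : ∀ m, G.Adj (p m) (p (m + 1)))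
    (hmin : ∀ m u, G.Adj (p m) u → t (p (m + 1)) ≤ t u) :
    ∀ m, (∀ i, i + 2 ≤ m → p (i + 2) ≠ p i) → IsFreshWalk G (p m :: seqTail p m)
  | 0, _ => trivial
  | 1, _ => ⟨hadj 0, by simp [seqTail, exposed], trivial⟩
  | 2, _ => ⟨hadj 1, by simp [seqTail, exposed], hadj 0, by simp [seqTail, exposed], trivial⟩
  | m + 3, hne => by
    have ih := isFreshWalk_seqTail ht hadj hmin (m + 2) fun i hi => hne i (by omega)
    refine ⟨hadj _, fun hmem => hne (m + 1) (by omega) (ht (le_antisymm ?_ ?_)), ih⟩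
    · exact hmin (m + 2) _ (hadj (m + 1)).symm
    · exact head_le_of_mem_pathEvent (L := seqTail p m) ih.of_cons
        (mem_pathEvent_seqTail hmin (m + 1)) _ hmem

open Classical in
/-- The number of clients other than `k` whose orbit under `f` visits `k`. -/
noncomputable def numVisits (s : V → Bool) (f : V → V) (k : V) : ℕ :=
  (Finset.univ.filter fun v => v ≠ k ∧ s v = true ∧ ∃ n, f^[n] v = k).card

open Classical in
theorem IsInstance.numVisits_le (h : IsInstance G r s) (ht : Function.Injective t) {f : V → V}
    (hf : ∀ v u, G.Adj v u → G.Adj v (f v) ∧ t (f v) ≤ t u) {k : V} (hk : s k = true) :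
    (numVisits s f k : ℝ) ≤ ∑ l ∈ Finset.range (Fintype.card V),
      ∑ L ∈ listsOfLength V (2 * (l + 1)),
        if IsFreshWalk G (k :: L) ∧ t ∈ pathEvent G (k :: L) then (1 : ℝ) else 0 := by
  set T : Finset (List V) := (Finset.range (Fintype.card V)).biUnion fun l =>
    (listsOfLength V (2 * (l + 1))).filter fun L =>
      IsFreshWalk G (k :: L) ∧ t ∈ pathEvent G (k :: L) with hT
  -- A walk determines its starting client as the last entry of the list, so visiting clients are no
  -- more numerous than walks.
  have hsub : (Finset.univ.filter fun v => v ≠ k ∧ s v = true ∧ ∃ n, f^[n] v = k).image some ⊆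
      T.image List.getLast? := by
    intro o ho
    obtain ⟨v, hv, rfl⟩ := Finset.mem_image.1 ho
    obtain ⟨hvk, hsv, hex⟩ := (Finset.mem_filter.1 hv).2
    set p : ℕ → V := fun n => f^[n] v with hp
    have hpsucc : ∀ n, p (n + 1) = f (p n) := fun n => Function.iterate_succ_apply' f n v
    have hnb : ∃ u, G.Adj v u := by
      by_contra hno
      have : nbrs G v = ∅ := by
        ext u
        simpa [mem_nbrs] using fun hu => hno ⟨u, hu⟩
      have h1 := h.sum_nbrs v hsv
      rw [this, Finset.sum_empty] at h1
      exact zero_ne_one h1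
    have hnbr : ∀ n, ∃ u, G.Adj (p n) u := by
      intro n
      induction n with
      | zero => exact hnb
      | succ n ih =>
        obtain ⟨u, hu⟩ := ih
        exact ⟨p n, by rw [hpsucc]; exact (hf _ _ hu).1.symm⟩
    have hadj : ∀ n, G.Adj (p n) (p (n + 1)) := by
      intro n
      obtain ⟨u, hu⟩ := hnbr n
      rw [hpsucc]
      exact (hf _ _ hu).1
    have hmin : ∀ n u, G.Adj (p n) u → t (p (n + 1)) ≤ t u := by
      intro n u hu
      rw [hpsucc]
      exact (hf _ _ hu).2
    have hside : ∀ n, s (p (2 * n)) = true := by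
      intro n
      induction n with
      | zero => exact hsv
      | succ n ih => exact h.side_eq ih (hadj _) (hadj _)
    set n := Nat.find hex with hn
    have hpn : p n = k := Nat.find_spec hex
    have hlt : ∀ m, m < n → p m ≠ k := fun m hm => Nat.find_min hex hm
    -- Cutting out a repetition would give a visit to `k` before the first one.
    have hinj : ∀ a b, a < b → b ≤ n → p a ≠ p b := by
      intro a b hab hbn hpab
      refine hlt (a + (n - b)) (by omega) ?_
      have h1 : p (a + (n - b)) = f^[n - b] (p a) := by
        rw [hp, Nat.add_comm]; exact Function.iterate_add_apply f _ _ v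
      have h2 : p n = f^[n - b] (p b) := by
        rw [hp]
        conv_lhs => rw [show n = (n - b) + b by omega]
        exact Function.iterate_add_apply f _ _ v
      rw [h1, hpab, ← h2, hpn]
    have hn0 : n ≠ 0 := by
      intro h0
      rw [h0] at hpn
      exact hvk hpn
    have heven : ∃ l, n = 2 * (l + 1) := by
      rcases Nat.even_or_odd' n with ⟨c, hc | hc⟩
      · exact ⟨c - 1, by omega⟩
      · have h1 := h.side_ne _ _ (hadj (2 * c))
        rw [← hc, hpn, hk, hside c] at h1
        exact (h1 rfl).elim
    obtain ⟨l, hl⟩ := heven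
    -- The vertices up to the first visit are distinct, which justifies the finite range of `l`.
    have hcard : n + 1 ≤ Fintype.card V := by
      have : Function.Injective fun i : Fin (n + 1) => p i := by
        intro a b hab
        rcases lt_trichotomy (a : ℕ) b with hlt | heq | hgt
        · exact (hinj a b hlt (by omega) hab).elim
        · exact Fin.ext heq
        · exact (hinj b a hgt (by omega) hab.symm).elim
      simpa using Fintype.card_le_of_injective _ this
    have hfresh := isFreshWalk_seqTail ht hadj hmin n fun i hi => (hinj i (i + 2) (by omega) hi).symm
    have hevent := mem_pathEvent_seqTail hmin n
    rw [hpn] at hfresh hevent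
    refine Finset.mem_image.2 ⟨seqTail p n, ?_, ?_⟩
    · rw [hT, Finset.mem_biUnion]
      refine ⟨l, Finset.mem_range.2 (by omega), Finset.mem_filter.2 ⟨?_, hfresh, hevent⟩⟩
      rw [mem_listsOfLength, length_seqTail, hl]
    · rw [show n = (n - 1) + 1 by omega, getLast?_seqTail]
      rfl
  have h1 : numVisits s f k ≤ T.card := by
    have := Finset.card_le_card hsub
    rw [Finset.card_image_of_injective _ (Option.some_injective V)] at this
    exact this.trans Finset.card_image_le
  have h2 : T.card ≤ ∑ l ∈ Finset.range (Fintype.card V),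
      ((listsOfLength V (2 * (l + 1))).filter fun L =>
        IsFreshWalk G (k :: L) ∧ t ∈ pathEvent G (k :: L)).card := Finset.card_biUnion_le
  have h3 : (numVisits s f k : ℝ) ≤ ((∑ l ∈ Finset.range (Fintype.card V),
      ((listsOfLength V (2 * (l + 1))).filter fun L =>
        IsFreshWalk G (k :: L) ∧ t ∈ pathEvent G (k :: L)).card : ℕ) : ℝ) := by
    exact_mod_cast h1.trans h2
  refine h3.trans (le_of_eq ?_)
  push_cast
  refine Finset.sum_congr rfl fun l _ => ?_
  rw [Finset.card_filter]
  push_cast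
  rfl

open Classical in
/-- The expected number of clients other than `k` whose walk visits `k` is at most three. -/
theorem IsInstance.integral_numVisits_le (h : IsInstance G r s) {k : V} (hk : s k = true)
    {f : (V → ℝ) → V → V}
    (hf : ∀ t v u, G.Adj v u → G.Adj v (f t v) ∧ t (f t v) ≤ t u)
    (hint : Integrable (fun t => (numVisits s (f t) k : ℝ)) (clockLaw r)) :
    ∫ t, (numVisits s (f t) k : ℝ) ∂(clockLaw r) ≤ 3 := by
  have := isProbabilityMeasure_clockLaw h.pos
  have hterm : ∀ L : List V, (fun t : V → ℝ =>
      if IsFreshWalk G (k :: L) ∧ t ∈ pathEvent G (k :: L) then (1 : ℝ) else 0) =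
      (if IsFreshWalk G (k :: L) then pathEvent G (k :: L) else ∅).indicator 1 := by
    intro L
    funext t
    by_cases hw : IsFreshWalk G (k :: L) <;> simp [hw, Set.indicator_apply]
  have hms : ∀ L : List V,
      MeasurableSet (if IsFreshWalk G (k :: L) then pathEvent G (k :: L) else ∅) := by
    intro L
    split_ifs
    · exact measurableSet_pathEvent _
    · exact MeasurableSet.empty
  have hi : ∀ L : List V, Integrable (fun t : V → ℝ =>
      if IsFreshWalk G (k :: L) ∧ t ∈ pathEvent G (k :: L) then (1 : ℝ) else 0) (clockLaw r) := by
    intro L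
    rw [hterm]
    exact (integrable_const (1 : ℝ)).indicator (hms L)
  calc ∫ t, (numVisits s (f t) k : ℝ) ∂(clockLaw r)
      ≤ ∫ t, ∑ l ∈ Finset.range (Fintype.card V), ∑ L ∈ listsOfLength V (2 * (l + 1)),
          (if IsFreshWalk G (k :: L) ∧ t ∈ pathEvent G (k :: L) then (1 : ℝ) else 0)
          ∂(clockLaw r) := by
        refine integral_mono_ae hint
          (integrable_finsetSum _ fun l _ => integrable_finsetSum _ fun L _ => hi L) ?_
        filter_upwards [ae_injective_clockLaw h.pos] with t ht
        exact h.numVisits_le ht (hf t) hk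
    _ = ∑ l ∈ Finset.range (Fintype.card V), ∑ L ∈ listsOfLength V (2 * (l + 1)),
          walkProb G r k L := by
        rw [integral_finsetSum _ fun l _ => integrable_finsetSum _ fun L _ => hi L]
        refine Finset.sum_congr rfl fun l _ => ?_
        rw [integral_finsetSum _ fun L _ => hi L]
        refine Finset.sum_congr rfl fun L _ => ?_
        rw [hterm, integral_indicator_one (hms L), walkProb]
        split_ifs <;> simp
    _ ≤ 3 := h.sum_sum_walkProb_le hk _

end Walks

/-! ### A changed path must visit the changed client -/

section Deterministic

variable {F C : Type*}

theorem next_adj [Finite F] [Finite C] {x : F → C → ℝ} (t : F ⊕ C → ℝ) {v u : F ⊕ C}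
    (h : (supportGraph x).Adj v u) :
    (supportGraph x).Adj v (next x t v) ∧ t (next x t v) ≤ t u := by
  have hex := exists_arc x t h
  have : (connectionGraph x t).Adj v (next x t v) := by
    rw [next, dif_pos hex]
    exact hex.choose_spec
  exact ⟨this.1, this.2 u h⟩

theorem connectionPath_congr {x x' : F → C → ℝ} {t t' : F ⊕ C → ℝ} {j : C}
    (h : ∀ n, (next x t)^[n] (Sum.inr j) = (next x' t')^[n] (Sum.inr j)) :
    connectionPath x t j = connectionPath x' t' j := by
  simp only [connectionPath, pathLength, h]

theorem adj_congr_of_ne {xA xB : F → C → ℝ} {k : C} (hx : ∀ i j, j ≠ k → xA i j = xB i j)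
    {v u : F ⊕ C} (hv : v ≠ Sum.inr k) (hu : u ≠ Sum.inr k) (h : (supportGraph xA).Adj v u) :
    (supportGraph xB).Adj v u := by
  rcases h with ⟨i, j, rfl, rfl, h⟩ | ⟨i, j, rfl, rfl, h⟩
  · rw [hx i j fun h => hu (h ▸ rfl)] at h
    exact Or.inl ⟨i, j, rfl, rfl, h⟩
  · rw [hx i j fun h => hv (h ▸ rfl)] at h
    exact Or.inr ⟨i, j, rfl, rfl, h⟩

/-- If the connection path of a client changes, then it visits the client whose connection variables
were changed. -/
theorem connectionPath_eq_of_not_visits [Finite F] [Finite C] {xA xB : F → C → ℝ} {k : C}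
    (hx : ∀ i j, j ≠ k → xA i j = xB i j) {t : F ⊕ C → ℝ} (ht : Function.Injective t) {j : C}
    (hj : ∃ i, 0 < xA i j)
    (hA : ∀ n, (next xA t)^[n] (Sum.inr j) ≠ Sum.inr k)
    (hB : ∀ n, (next xB t)^[n] (Sum.inr j) ≠ Sum.inr k) :
    connectionPath xA t j = connectionPath xB t j := by
  have key : ∀ n, (next xA t)^[n] (Sum.inr j) = (next xB t)^[n] (Sum.inr j) ∧
      ∃ u, (supportGraph xA).Adj ((next xA t)^[n] (Sum.inr j)) u := by
    intro n
    induction n with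
    | zero =>
      obtain ⟨i, hi⟩ := hj
      exact ⟨rfl, Sum.inl i, Or.inr ⟨i, j, rfl, rfl, hi⟩⟩
    | succ n ih =>
      obtain ⟨heq, u, hu⟩ := ih
      have hAn := hA n
      have hAs := hA (n + 1)
      have hBs := hB (n + 1)
      rw [Function.iterate_succ_apply'] at hAs hBs
      rw [Function.iterate_succ_apply', Function.iterate_succ_apply']
      rw [← heq] at hBs ⊢
      set v := (next xA t)^[n] (Sum.inr j)
      have h1 := (next_adj t hu).1
      have h2 := adj_congr_of_ne hx hAn hAs h1
      have h3 := (next_adj t h2).1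
      have h4 := adj_congr_of_ne (fun i j hj => (hx i j hj).symm) hAn hBs h3
      -- Both heads avoid `k`, so each is a neighbour in both graphs and rings no later than the
      -- other.
      exact ⟨ht (le_antisymm (next_adj t h4).2 (next_adj t h2).2), v, h1.symm⟩
  exact connectionPath_congr fun n => (key n).1

theorem numPathChanges_le [Fintype F] [Fintype C] {xA xB : F → C → ℝ} {k : C}
    (hx : ∀ i j, j ≠ k → xA i j = xB i j) {t : F ⊕ C → ℝ} (ht : Function.Injective t)
    (hA : ∀ j, ∃ i, 0 < xA i j) :
    numPathChanges xA xB t ≤ 1 + numVisits Sum.isRight (next xA t) (Sum.inr k) +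
      numVisits Sum.isRight (next xB t) (Sum.inr k) := by
  classical
  have hsub : (Sum.inr '' {j : C | connectionPath xA t j ≠ connectionPath xB t j} : Set (F ⊕ C)) ⊆
      (({Sum.inr k} ∪
        (Finset.univ.filter fun v : F ⊕ C => v ≠ Sum.inr k ∧ v.isRight = true ∧
          ∃ n, (next xA t)^[n] v = Sum.inr k) ∪
        (Finset.univ.filter fun v : F ⊕ C => v ≠ Sum.inr k ∧ v.isRight = true ∧
          ∃ n, (next xB t)^[n] v = Sum.inr k) : Finset (F ⊕ C)) : Set (F ⊕ C)) := by
    rintro _ ⟨j, hj, rfl⟩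
    by_contra hno
    simp only [Finset.coe_union, Finset.coe_singleton, Finset.coe_filter, Set.mem_union,
      Set.mem_singleton_iff, Finset.mem_univ, true_and, Set.mem_ofPred_eq, not_or, not_and,
      not_exists, Sum.isRight_inr] at hno
    exact hj (connectionPath_eq_of_not_visits hx ht (hA j) (hno.1.2 hno.1.1) (hno.2 hno.1.1))
  have h1 := Set.ncard_le_ncard hsub (Finset.finite_toSet _)
  rw [Set.ncard_image_of_injective _ Sum.inr_injective, Set.ncard_coe_finset] at h1
  have h2 := h1.trans (Finset.card_union_le _ _)
  refine h2.trans ((Nat.add_le_add_right (Finset.card_union_le _ _) _).trans ?_)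
  rw [Finset.card_singleton]
  unfold numVisits
  exact le_of_eq (by congr!)

end Deterministic

/-! ### Dependence on the clocks through their order only -/

section Measurability

/-- A function of the clocks that depends only on their order is measurable. -/
theorem measurable_of_order {V : Type*} [Fintype V] {g : (V → ℝ) → ℝ}
    (hg : ∀ t t' : V → ℝ, (∀ u w, t u ≤ t w ↔ t' u ≤ t' w) → g t = g t') : Measurable g := by
  classical
  -- There are finitely many comparison patterns, so every function of the pattern is measurable.
  set pat : (V → ℝ) → V × V → Bool := fun t p => decide (t p.1 ≤ t p.2) with hpat
  have hm : Measurable pat := by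
    refine measurable_pi_lambda _ fun p => measurable_to_bool ?_
    have : (fun t : V → ℝ => pat t p) ⁻¹' {true} = {t | t p.1 ≤ t p.2} := by
      ext t; simp [hpat]
    rw [this]
    exact measurableSet_le (measurable_pi_apply _) (measurable_pi_apply _)
  have hfac : Function.FactorsThrough g pat := by
    intro t t' h
    refine hg t t' fun u w => ?_
    have := congrFun h (u, w)
    simpa [hpat] using this
  have : g = Function.extend pat g 0 ∘ pat := by
    funext t
    exact (hfac.extend_apply 0 t).symm
  rw [this]
  exact (measurable_of_finite _).comp hm

theorem integrable_of_order {V : Type*} [Fintype V] {r : V → ℝ} (hr : ∀ v, 0 < r v)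
    {g : (V → ℝ) → ℕ} {N : ℕ} (hN : ∀ t, g t ≤ N)
    (hg : ∀ t t' : V → ℝ, (∀ u w, t u ≤ t w ↔ t' u ≤ t' w) → g t = g t') :
    Integrable (fun t => (g t : ℝ)) (clockLaw r) := by
  have := isProbabilityMeasure_clockLaw hr
  refine Integrable.of_bound (measurable_of_order fun t t' h => ?_).aestronglyMeasurable N ?_
  · rw [hg t t' h]
  · refine Filter.Eventually.of_forall fun t => ?_
    rw [Real.norm_of_nonneg (Nat.cast_nonneg _)]
    exact_mod_cast hN t

variable {F C : Type*}

/-- Only comparisons between neighbours of a common vertex enter. This yields both measurability and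
independence of the clocks of rate zero. -/
theorem next_congr {x : F → C → ℝ} {t t' : F ⊕ C → ℝ}
    (h : ∀ v u w, (supportGraph x).Adj v u → (supportGraph x).Adj v w →
      (t w ≤ t u ↔ t' w ≤ t' u)) : next x t = next x t' := by
  have heq : connectionGraph x t = connectionGraph x t' := by
    ext v w
    refine and_congr_right fun hw => ?_
    exact forall₂_congr fun u hu => h v u w hu hw
  unfold next
  rw [heq]

theorem connectionPath_congr_of_next_eq {x : F → C → ℝ} {t t' : F ⊕ C → ℝ}
    (h : next x t = next x t') (j : C) : connectionPath x t j = connectionPath x t' j :=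
  connectionPath_congr fun n => by rw [h]

theorem numPathChanges_congr {xA xB : F → C → ℝ} {t t' : F ⊕ C → ℝ}
    (hA : next xA t = next xA t') (hB : next xB t = next xB t') :
    numPathChanges xA xB t = numPathChanges xA xB t' := by
  simp only [numPathChanges, connectionPath_congr_of_next_eq hA, connectionPath_congr_of_next_eq hB]

theorem numReassigned_congr {xA xB : F → C → ℝ} {t t' : F ⊕ C → ℝ}
    (hA : next xA t = next xA t') (hB : next xB t = next xB t') :
    numReassigned xA xB t = numReassigned xA xB t' := by
  simp only [numReassigned, assigned, connectionPath_congr_of_next_eq hA,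
    connectionPath_congr_of_next_eq hB]

theorem numPathChanges_le_card [Fintype C] (xA xB : F → C → ℝ) (t : F ⊕ C → ℝ) :
    numPathChanges xA xB t ≤ Fintype.card C := by
  rw [← Nat.card_eq_fintype_card, numPathChanges]
  exact Set.ncard_le_card _

theorem numReassigned_le_numPathChanges [Finite C] (xA xB : F → C → ℝ) (t : F ⊕ C → ℝ) :
    numReassigned xA xB t ≤ numPathChanges xA xB t := by
  refine Set.ncard_le_ncard (fun j hj hpath => hj ?_) (Set.toFinite _)
  rw [assigned, assigned, hpath]

theorem numPathChanges_triangle [Finite C] (xA x xB : F → C → ℝ) (t : F ⊕ C → ℝ) :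
    numPathChanges xA xB t ≤ numPathChanges xA x t + numPathChanges x xB t := by
  refine (Set.ncard_le_ncard (fun j hj => ?_) (Set.toFinite _)).trans (Set.ncard_union_le _ _)
  by_contra hno
  rw [Set.mem_union, not_or] at hno
  exact hj ((not_not.1 hno.1).trans (not_not.1 hno.2))

theorem numPathChanges_self (x : F → C → ℝ) (t : F ⊕ C → ℝ) : numPathChanges x x t = 0 := by
  simp [numPathChanges]

end Measurability

/-! ### Expectations, and transfer to the given clocks -/

section Expectation

variable {F C : Type*}

/-- The rates of the clocks, with rate one for the clocks that are never looked at. -/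
noncomputable def posRate (C : Type*) (o : F → ℝ) (v : F ⊕ C) : ℝ :=
  open Classical in if 0 < rate C o v then rate C o v else 1

/-- Fractional assignments in which facilities are used entirely or not at all. -/
def IsAdmissible [Fintype F] (o : F → ℝ) (x : F → C → ℝ) : Prop :=
  (∀ i j, x i j = 0 ∨ x i j = o i) ∧ ∀ j, ∑ i, x i j = 1

variable {o : F → ℝ}

theorem posRate_pos (v : F ⊕ C) : 0 < posRate C o v := by
  unfold posRate
  split_ifs with h
  · exact h
  · exact one_pos

theorem posRate_of_pos {v : F ⊕ C} (h : 0 < rate C o v) : posRate C o v = rate C o v := if_pos h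

variable [Fintype F]

theorem IsAdmissible.rate_pos {x : F → C → ℝ} (hx : IsAdmissible o x) {v u : F ⊕ C}
    (h : (supportGraph x).Adj v u) : 0 < rate C o u := by
  rcases h with ⟨i, j, rfl, rfl, h⟩ | ⟨i, j, rfl, rfl, h⟩
  · exact one_pos
  · rcases hx.1 i j with h0 | h0
    · exact (h.ne' h0).elim
    · rw [h0] at h
      exact h

theorem IsAdmissible.exists_pos {x : F → C → ℝ} (hx : IsAdmissible o x) (j : C) :
    ∃ i, 0 < x i j := by
  by_contra hno
  have h1 : ∑ i, x i j ≤ 0 := Finset.sum_nonpos fun i _ => not_lt.1 fun h => hno ⟨i, h⟩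
  rw [hx.2 j] at h1
  linarith

theorem isAdmissible_of_preprocessed {x : F → C → ℝ} {y : F → ℝ} (hx : (x, y) ∈ pFL F C)
    (hp : Preprocessed o x y) : IsAdmissible o x := by
  refine ⟨fun i j => ?_, hx.1⟩
  rcases hp.1 i j with h | h
  · exact Or.inl h
  · rw [h]
    exact hp.2 i

variable [Fintype C]

theorem IsAdmissible.isInstance (ho : ∀ i, 0 ≤ o i) {x : F → C → ℝ} (hx : IsAdmissible o x) :
    IsInstance (supportGraph x) (posRate C o) Sum.isRight where
  pos := posRate_pos
  side_ne := by
    rintro u v (⟨i, j, rfl, rfl, -⟩ | ⟨i, j, rfl, rfl, -⟩) <;> simp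
  client := by
    rintro (i | j) h
    · simp at h
    · exact if_pos one_pos
  sum_nbrs := by
    classical
    rintro (i | j) h
    · simp at h
    · have h1 : nbrs (supportGraph x) (Sum.inr j : F ⊕ C) =
          (Finset.univ.filter fun i => 0 < x i j).map Function.Embedding.inl := by
        ext u
        rw [mem_nbrs, Finset.mem_map]
        constructor
        · rintro (⟨i, j', h, -, -⟩ | ⟨i, j', h, rfl, hp⟩)
          · simp at h
          · rw [← Sum.inr.inj h] at hp
            exact ⟨i, by simpa using hp, rfl⟩
        · rintro ⟨i, hi, rfl⟩
          exact Or.inr ⟨i, j, rfl, rfl, by simpa using hi⟩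
      rw [h1, Finset.sum_map, Finset.sum_filter, ← hx.2 j]
      refine Finset.sum_congr rfl fun i _ => ?_
      rcases hx.1 i j with h0 | h0
      · simp [h0]
      · split_ifs with hp
        · rw [h0] at hp ⊢
          exact if_pos hp
        · rw [h0] at hp ⊢
          exact le_antisymm (ho i) (not_lt.1 hp)

theorem integrable_numPathChanges (xA xB : F → C → ℝ) :
    Integrable (fun t => (numPathChanges xA xB t : ℝ)) (clockLaw (posRate C o)) :=
  integrable_of_order posRate_pos (numPathChanges_le_card xA xB) fun _ _ h =>
    numPathChanges_congr (next_congr fun _ u w _ _ => h w u) (next_congr fun _ u w _ _ => h w u)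

theorem integral_numPathChanges_single_le (ho : ∀ i, 0 ≤ o i) {xA xB : F → C → ℝ}
    (hA : IsAdmissible o xA) (hB : IsAdmissible o xB) {k : C}
    (hx : ∀ i j, j ≠ k → xA i j = xB i j) :
    ∫ t, (numPathChanges xA xB t : ℝ) ∂(clockLaw (posRate C o)) ≤ 7 := by
  have := isProbabilityMeasure_clockLaw (posRate_pos (C := C) (o := o))
  have hint : ∀ x : F → C → ℝ, Integrable (fun t => (numVisits Sum.isRight (next x t)
      (Sum.inr k) : ℝ)) (clockLaw (posRate C o)) := fun x =>
    integrable_of_order posRate_pos (fun _ => Finset.card_le_univ _) fun _ _ h => by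
      rw [next_congr fun _ u w _ _ => h w u]
  have hvis : ∀ x : F → C → ℝ, IsAdmissible o x → ∫ t, (numVisits Sum.isRight (next x t)
      (Sum.inr k) : ℝ) ∂(clockLaw (posRate C o)) ≤ 3 := fun x hx =>
    (hx.isInstance ho).integral_numVisits_le rfl (fun t v u h => next_adj t h) (hint x)
  have hadd : Integrable (fun t => 1 + (numVisits Sum.isRight (next xA t) (Sum.inr k) : ℝ))
      (clockLaw (posRate C o)) := (integrable_const (1 : ℝ)).add (hint xA)
  calc ∫ t, (numPathChanges xA xB t : ℝ) ∂(clockLaw (posRate C o))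
      ≤ ∫ t, (1 + (numVisits Sum.isRight (next xA t) (Sum.inr k) : ℝ) +
          (numVisits Sum.isRight (next xB t) (Sum.inr k) : ℝ)) ∂(clockLaw (posRate C o)) := by
        refine integral_mono_ae (integrable_numPathChanges xA xB) (hadd.add (hint xB)) ?_
        filter_upwards [ae_injective_clockLaw posRate_pos] with t ht
        exact_mod_cast numPathChanges_le hx ht hA.exists_pos
    _ ≤ 7 := by
        rw [integral_add hadd (hint xB),
          integral_add (integrable_const (1 : ℝ)) (hint xA)]
        have h1 := hvis xA hA
        have h2 := hvis xB hB
        simp only [integral_const, probReal_univ, smul_eq_mul, mul_one]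
        linarith

theorem integral_numPathChanges_le (ho : ∀ i, 0 ≤ o i) {xB : F → C → ℝ}
    (hB : IsAdmissible o xB) (K : Finset C) : ∀ {xA : F → C → ℝ}, IsAdmissible o xA →
    (∀ i j, j ∉ K → xA i j = xB i j) →
    ∫ t, (numPathChanges xA xB t : ℝ) ∂(clockLaw (posRate C o)) ≤ 7 * (K.card : ℝ) := by
  classical
  induction K using Finset.induction_on with
  | empty =>
    intro xA _ hx
    have : xA = xB := by
      funext i j
      exact hx i j (Finset.notMem_empty j)
    simp [this, numPathChanges_self]
  | insert k K hk ih =>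
    intro xA hA hx
    -- The intermediate assignment takes the column of `k` from `xB` and the others from `xA`.
    -- Admissibility is a condition on each column separately, so it is inherited without reference
    -- to opening variables.
    set x : F → C → ℝ := fun i j => if j = k then xB i j else xA i j with hxdef
    have hxadm : IsAdmissible o x := by
      refine ⟨fun i j => ?_, fun j => ?_⟩
      · by_cases hj : j = k
        · simpa [hxdef, hj] using hB.1 i k
        · simpa [hxdef, hj] using hA.1 i j
      · by_cases hj : j = k
        · simpa [hxdef, hj] using hB.2 k
        · simpa [hxdef, hj] using hA.2 j
    have h1 : ∫ t, (numPathChanges xA x t : ℝ) ∂(clockLaw (posRate C o)) ≤ 7 :=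
      integral_numPathChanges_single_le ho hA hxadm (k := k) fun i j hj => by simp [hxdef, hj]
    have h2 := ih hxadm fun i j hj => by
      by_cases hjk : j = k
      · simp [hxdef, hjk]
      · simp only [hxdef, if_neg hjk]
        exact hx i j (by simp [hjk, hj])
    have h3 : ∫ t, (numPathChanges xA xB t : ℝ) ∂(clockLaw (posRate C o)) ≤
        ∫ t, ((numPathChanges xA x t : ℝ) + (numPathChanges x xB t : ℝ))
          ∂(clockLaw (posRate C o)) :=
      integral_mono (integrable_numPathChanges xA xB)
        ((integrable_numPathChanges xA x).add (integrable_numPathChanges x xB)) fun t => by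
          dsimp only
          exact_mod_cast numPathChanges_triangle xA x xB t
    rw [integral_add (integrable_numPathChanges xA x) (integrable_numPathChanges x xB)] at h3
    rw [Finset.card_insert_of_notMem hk]
    push_cast
    linarith

/-- Expectations of functions that ignore the clocks of rate zero can be computed under
`clockLaw`. -/
theorem IsExponentialClocks.integral_eq {Ω : Type*} [MeasurableSpace Ω] {P : Measure Ω}
    [IsProbabilityMeasure P] {T : F ⊕ C → Ω → ℝ} (hT : IsExponentialClocks (rate C o) T P)
    {g : (F ⊕ C → ℝ) → ℝ} (hgm : Measurable g)
    (hg : ∀ t t' : F ⊕ C → ℝ, (∀ v, 0 < rate C o v → t v = t' v) → g t = g t')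
    (hint : Integrable g (clockLaw (posRate C o))) :
    Integrable (fun ω => g fun v => T v ω) P ∧
      ∫ ω, g (fun v => T v ω) ∂P = ∫ t, g t ∂(clockLaw (posRate C o)) := by
  classical
  have := fun v => isProbabilityMeasure_expMeasure (posRate_pos (C := C) (o := o) v)
  -- Clocks of rate zero are filled in with 0. Thus `g` factors through the clocks of positive rate,
  -- whose joint law is the same product measure under `P` and under `clockLaw`.
  set ext : ({v : F ⊕ C // 0 < rate C o v} → ℝ) → F ⊕ C → ℝ :=
    fun q v => if h : 0 < rate C o v then q ⟨v, h⟩ else 0 with hext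
  have hextm : Measurable ext := by
    refine measurable_pi_lambda _ fun v => ?_
    by_cases h : 0 < rate C o v
    · simpa [hext, h] using measurable_pi_apply _
    · simp [hext, h]
  have hgext : ∀ t : F ⊕ C → ℝ, g t = (g ∘ ext) fun v => t v := by
    intro t
    refine hg _ _ fun v hv => ?_
    simp [hext, hv]
  have hmp : MeasurePreserving
      (fun (t : F ⊕ C → ℝ) (v : {v : F ⊕ C // 0 < rate C o v}) => t v)
      (clockLaw (posRate C o))
      (Measure.pi fun v : {v : F ⊕ C // 0 < rate C o v} => expMeasure (posRate C o v)) :=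
    measurePreserving_fst.comp
      (measurePreserving_piEquivPiSubtypeProd (fun v => expMeasure (posRate C o v)) _)
  have hTm : ∀ v : {v : F ⊕ C // 0 < rate C o v}, AEMeasurable (T v) P := fun v =>
    (hT.hasLaw v v.2).aemeasurable
  have hTlaw : P.map (fun ω (v : {v : F ⊕ C // 0 < rate C o v}) => T v ω) =
      Measure.pi fun v : {v : F ⊕ C // 0 < rate C o v} => expMeasure (posRate C o v) := by
    rw [(iIndepFun_iff_map_fun_eq_pi_map hTm).1 hT.indep]
    congr 1
    funext v
    rw [(hT.hasLaw v v.2).map_eq, posRate_of_pos v.2]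
  have hTm' : AEMeasurable (fun ω (v : {v : F ⊕ C // 0 < rate C o v}) => T v ω) P :=
    aemeasurable_pi_lambda _ hTm
  have hge : Measurable (g ∘ ext) := hgm.comp hextm
  have h1 : (fun ω => g fun v => T v ω) =
      (g ∘ ext) ∘ fun ω (v : {v : F ⊕ C // 0 < rate C o v}) => T v ω := by
    funext ω
    exact hgext _
  have h2 : g = (g ∘ ext) ∘
      fun (t : F ⊕ C → ℝ) (v : {v : F ⊕ C // 0 < rate C o v}) => t v := by
    funext t
    exact hgext t
  constructor
  · rw [h1, ← integrable_map_measure hge.aestronglyMeasurable hTm', hTlaw,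
      ← hmp.integrable_comp hge.aestronglyMeasurable, ← h2]
    exact hint
  · have h3 : ∫ ω, g (fun v => T v ω) ∂P =
        ∫ ω, (g ∘ ext) (fun v : {v : F ⊕ C // 0 < rate C o v} => T v ω) ∂P :=
      integral_congr_ae (Filter.Eventually.of_forall fun ω => hgext _)
    have h4 : ∫ t, g t ∂(clockLaw (posRate C o)) =
        ∫ t, (g ∘ ext) (fun v : {v : F ⊕ C // 0 < rate C o v} => t v) ∂(clockLaw (posRate C o)) :=
      integral_congr_ae (Filter.Eventually.of_forall fun t => hgext _)
    rw [h3, h4, ← integral_map hTm' hge.aestronglyMeasurable, hTlaw, ← hmp.map_eq,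
      integral_map hmp.aemeasurable hge.aestronglyMeasurable]

end Expectation

end DynamicFacility

open DynamicFacility in
theorem mainTheorem3 {F C Ω : Type*} [Fintype F] [Fintype C] [MeasurableSpace Ω]
    (P : Measure Ω) [IsProbabilityMeasure P]
    (o : F → ℝ) (ho : ∀ i, o i ∈ Set.Icc (0 : ℝ) 1)
    (xA xB : F → C → ℝ) (yA yB : F → ℝ)
    (hA : (xA, yA) ∈ DynamicFacility.pFL F C) (hB : (xB, yB) ∈ DynamicFacility.pFL F C)
    (hpA : DynamicFacility.Preprocessed o xA yA) (hpB : DynamicFacility.Preprocessed o xB yB)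
    (T : F ⊕ C → Ω → ℝ)
    (hT : DynamicFacility.IsExponentialClocks (DynamicFacility.rate C o) T P) :
    (∀ k : C, (∀ i j, j ≠ k → xA i j = xB i j) →
      Integrable (fun ω => (DynamicFacility.numPathChanges xA xB (fun v => T v ω) : ℝ)) P ∧
      ∫ ω, (DynamicFacility.numPathChanges xA xB (fun v => T v ω) : ℝ) ∂P ≤ 7) ∧
    (∀ K : Finset C, (∀ i j, j ∉ K → xA i j = xB i j) →
      Integrable (fun ω => (DynamicFacility.numReassigned xA xB (fun v => T v ω) : ℝ)) P ∧
      ∫ ω, (DynamicFacility.numReassigned xA xB (fun v => T v ω) : ℝ) ∂P ≤ 7 * (K.card : ℝ)) := by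
  have hA' := isAdmissible_of_preprocessed hA hpA
  have hB' := isAdmissible_of_preprocessed hB hpB
  have ho' : ∀ i, 0 ≤ o i := fun i => (ho i).1
  have hnext : ∀ {x : F → C → ℝ}, IsAdmissible o x → ∀ t t' : F ⊕ C → ℝ,
      (∀ v, 0 < rate C o v → t v = t' v) → next x t = next x t' := by
    intro x hx t t' h
    refine next_congr fun v u w hu hw => ?_
    rw [h u (hx.rate_pos hu), h w (hx.rate_pos hw)]
  have horder : ∀ (x : F → C → ℝ) (t t' : F ⊕ C → ℝ),
      (∀ u w, t u ≤ t w ↔ t' u ≤ t' w) → next x t = next x t' :=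
    fun x t t' h => next_congr fun _ u w _ _ => h w u
  constructor
  · intro k hk
    have h1 := hT.integral_eq (g := fun t => (numPathChanges xA xB t : ℝ))
      (measurable_of_order fun t t' h => by
        rw [numPathChanges_congr (horder xA t t' h) (horder xB t t' h)])
      (fun t t' h => by rw [numPathChanges_congr (hnext hA' t t' h) (hnext hB' t t' h)])
      (integrable_numPathChanges xA xB)
    exact ⟨h1.1, h1.2.trans_le (integral_numPathChanges_single_le ho' hA' hB' hk)⟩
  · intro K hK
    have hint : Integrable (fun t => (numReassigned xA xB t : ℝ)) (clockLaw (posRate C o)) :=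
      integrable_of_order posRate_pos
        (fun t => (numReassigned_le_numPathChanges xA xB t).trans (numPathChanges_le_card xA xB t))
        fun t t' h => numReassigned_congr (horder xA t t' h) (horder xB t t' h)
    have h1 := hT.integral_eq (g := fun t => (numReassigned xA xB t : ℝ))
      (measurable_of_order fun t t' h => by
        rw [numReassigned_congr (horder xA t t' h) (horder xB t t' h)])
      (fun t t' h => by rw [numReassigned_congr (hnext hA' t t' h) (hnext hB' t t' h)]) hint
    refine ⟨h1.1, h1.2.trans_le (le_trans ?_ (integral_numPathChanges_le ho' hB' K hA' hK))⟩
    exact integral_mono hint (integrable_numPathChanges xA xB) fun t =>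
      Nat.cast_le.2 (numReassigned_le_numPathChanges xA xB t)
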